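/- **Definitions.** A conjunctive query $Q=\exists X_1,\dots,X_n\,\Phi$ is given by a nonempty finite conjunction $\Phi$ of atoms $r(\mathbf u)$, where $\mathbf u$ is a finite list of variables and constants; $\mathit{vars}(Q)$ is the set of variables occurring in $\Phi$ and $\mathit{free}(Q)=\mathit{vars}(Q)\setminus\{X_1,\dots,X_n\}$. We view $Q$ as a relational structure whose elements are the terms occurring in $\Phi$ and whose tuples are the atoms. Its size $\|Q\|$ is the number of relation symbols of $Q$, plus the number of terms of $Q$, plus the sum of the arities of the distinct atoms of $Q$. A *view set* for $Q$ is a finite set $\mathcal V$ of atoms over relation symbols not occurring in $Q$ such that for each atom of $Q$ there is an atom in $\mathcal V$ with the same list of variables. The query $\mathit{color}(Q)$ is obtained from $Q$ by adding an atom $r_X(X)$, with a fresh relation symbol $r_X$, for each $X\in\mathit{free}(Q)$. A *core* of a query is a minimal substructure $Q'$ of it such that there is a homomorphism (fixing all constants) from the query to $Q'$. For a set $A$ of atoms, $\mathcal H_A$ is the hypergraph whose nodes are the variables of $A$ and whose hyperedges are the sets of variables of the atoms in $A$. Write $\mathcal H_1\le\mathcal H_2$ if each hyperedge of $\mathcal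 H_1$ is contained in a hyperedge of $\mathcal H_2$. A hypergraph is *acyclic* if it has a join tree, i.e. a tree whose vertices are its hyperedges such that, for each node $X$, the hyperedges containing $X$ induce a connected subtree. For a hypergraph $\mathcal H$ and a set $W$, two nodes are $[W]$-adjacent if some hyperedge $h$ has both of them in $h\setminus W$; the $[W]$-components are the classes of nodes outside $W$ that are linked by sequences of $[W]$-adjacent nodes. The *frontier* $\mathit{Fr}(Y,W,\mathcal H)$ is $\emptyset$ if $Y\in W$, and otherwise the set of all elements of $W$ that belong to a hyperedge meeting the $[W]$-component of $Y$. The *frontier hypergraph* $\mathcal{FH}(Q',W)$ has node set $\mathit{vars}(Q')\cup W$, and its hyperedges are the sets $\mathit{Fr}(Y,W,\mathcal H_{Q'})$ for $Y\in\mathit{vars}(Q')$ together with the hyperedges of $\mathcal H_{Q'}$ contained in $W$. A *#-decomposition* of $Q$ w.r.t. $\mathcal V$ is a finite acyclic hypergraph $\mathcal H_a$ such that, for some core $Q'$ of $\mathit{color}(Q)$, $\mathcal H_{Q'}\le\mathcal H_a\le\mathcal H_{\mathcal V}$ and $\mathcal{FH}(Q',\mathit{free}(Q))\le\mathcal H_a$.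 **Theorem.** The following problem, parameterized by the query size $\|Q\|$, is fixed-parameter tractable: given a query $Q$ and a view set $\mathcal V$ for $Q$, decide whether there exists a #-decomposition of $Q$ w.r.t. $\mathcal V$, and compute one if there is any. That is, there are an algorithm, a computable function $f:\mathbb N\to\mathbb N$ and a constant $c\in\mathbb N$ such that, for every query $Q$ and every view set $\mathcal V$ for $Q$, the algorithm on input $(Q,\mathcal V)$ halts in time at most $f(\|Q\|)\cdot|I|^c$, where $|I|$ is the length of the encoding of the input (with names of variables, constants and relation symbols written in binary), and outputs a #-decomposition of $Q$ w.r.t. $\mathcal V$ if one exists, and "no" otherwise. -/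

import Mathlib

namespace SharpDec

/-! ## Conjunctive queries

The universe of variables and the universe of constants are two disjoint copies of `ℕ`.
`R` is the type of names of relation symbols. -/

/-- A term is a variable or a constant. -/
inductive Term where
  | var (X : ℕ)
  | const (c : ℕ)
  deriving DecidableEq

/-- The variable that a term is, if it is one. -/
def Term.var? : Term → Option ℕ
  | .var X => some X
  | .const _ => none

/-- An atom `r(u₁, …, uₙ)`. -/
structure Atom (R : Type) where
  rel : R
  args : List Term
  deriving DecidableEq

namespace Atom

variable {R : Type}

/-- The relation symbol of an atom. A relation symbol carries its arity, so the same name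
used with two arities counts as two symbols. -/
def symbol (a : Atom R) : R × ℕ := (a.rel, a.args.length)

/-- The list of variables of an atom, in order, with repetitions. -/
def varList (a : Atom R) : List ℕ := a.args.filterMap Term.var?

/-- The set of variables of an atom. -/
def vars (a : Atom R) : Set ℕ := {X | X ∈ a.varList}

/-- The atom `r(h(u₁), …, h(uₙ))`. -/
def map (h : Term → Term) (a : Atom R) : Atom R := ⟨a.rel, a.args.map h⟩

end Atom

/-- A conjunctive query `∃ X₁ … Xₙ, r₁(u₁) ∧ … ∧ rₘ(uₘ)` with `m > 0`. -/
structure Query (R : Type) where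
  atoms : List (Atom R)
  quantified : List ℕ
  atoms_ne_nil : atoms ≠ []

namespace Query

variable {R : Type}

/-- The list of the free variables (with repetitions): the variables that occur in an atom
and are not quantified. -/
def freeList (Q : Query R) : List ℕ :=
  (Q.atoms.flatMap Atom.varList).filter (fun X => X ∉ Q.quantified)

/-- The set of the free variables. -/
def free (Q : Query R) : Set ℕ := {X | X ∈ Q.freeList}

/-- The set of atoms. With it a query is viewed as a relational structure: its universe consists
of the terms that occur in the atoms, and a tuple is in a relation iff that atom is present. -/
def atomSet (Q : Query R) : Set (Atom R) := {a | a ∈ Q.atoms}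

/-- The size `‖Q‖` of the relational structure of `Q`: the number of relation symbols, plus the
number of elements of the universe, plus the sum, over all tuples of all relations, of the arity.
It does not depend on the names of symbols, variables and constants. -/
def size [DecidableEq R] (Q : Query R) : ℕ :=
  (Q.atoms.map Atom.symbol).toFinset.card + (Q.atoms.flatMap Atom.args).toFinset.card
    + ∑ a ∈ Q.atoms.toFinset, a.args.length

/-- The coloring of `Q`: an atom `r_X(X)` is added for each free variable `X`, where the
relation symbol `r_X`, here `Sum.inr X`, is fresh. -/
def color (Q : Query R) : Query (R ⊕ ℕ) where
  atoms := Q.atoms.map (fun a => ⟨Sum.inl a.rel, a.args⟩)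
    ++ Q.freeList.map (fun X => ⟨Sum.inr X, [Term.var X]⟩)
  quantified := Q.quantified
  atoms_ne_nil := by
    intro h
    exact Q.atoms_ne_nil (List.map_eq_nil_iff.1 (List.append_eq_nil_iff.1 h).1)

end Query

/-- `V` is a view set for `Q`: the relation symbols of the views do not occur in `Q`, and for
each atom of `Q` there is a view with the same list of variables. -/
def IsViewSet (V : List (Atom ℕ)) (Q : Query ℕ) : Prop :=
  (∀ w ∈ V, ∀ q ∈ Q.atoms, w.symbol ≠ q.symbol) ∧
    ∀ q ∈ Q.atoms, ∃ w ∈ V, w.varList = q.varList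

/-- A homomorphism between the relational structures given by the atoms in `A` and in `B`:
it fixes the constants and maps tuples to tuples. Only the values on the terms that occur in `A`
matter, and those are mapped to terms that occur in `B`. -/
def IsHom {R : Type} (h : Term → Term) (A B : Set (Atom R)) : Prop :=
  (∀ c, h (.const c) = .const c) ∧ ∀ a ∈ A, a.map h ∈ B

/-- `A'` is a core of `A`: a minimal substructure of `A` to which `A` has a homomorphism. -/
def IsCore {R : Type} (A' A : Set (Atom R)) : Prop :=
  Minimal (fun B => B ⊆ A ∧ ∃ h, IsHom h A B) A'

/-! ## Hypergraphs -/

/-- The hypergraph of a set of atoms: one hyperedge for each atom, with all its variables. -/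
def hypergraphOf {R : Type} (A : Set (Atom R)) : Hypergraph ℕ where
  vertexSet := ⋃ a ∈ A, a.vars
  edgeSet := Atom.vars '' A
  subset_vertexSet_of_mem_edgeSet' := by
    rintro _ ⟨a, ha, rfl⟩
    exact Set.subset_biUnion_of_mem (u := Atom.vars) ha

/-- `H₁ ≤ H₂`: each hyperedge of `H₁` is contained in a hyperedge of `H₂`. -/
def Covers {α : Type} (H₁ H₂ : Hypergraph α) : Prop :=
  ∀ e ∈ H₁.edgeSet, ∃ e' ∈ H₂.edgeSet, e ⊆ e'

/-- `T` is a join tree of `H`: a tree on the hyperedges in which, for each node `X`, the hyperedges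
that contain `X` induce a connected subtree (possibly empty). -/
def IsJoinTree {α : Type} (H : Hypergraph α) (T : SimpleGraph H.edgeSet) : Prop :=
  T.IsAcyclic ∧ T.Preconnected ∧
    ∀ X ∈ H.vertexSet, (T.induce {e : H.edgeSet | X ∈ e.1}).Preconnected

/-- `α`-acyclicity. -/
def IsAcyclic {α : Type} (H : Hypergraph α) : Prop := ∃ T, IsJoinTree H T

/-- `Ha` is a tree projection of `H₁` with respect to `H₂`. -/
def IsTreeProjection {α : Type} (Ha H₁ H₂ : Hypergraph α) : Prop :=
  Ha.vertexSet.Finite ∧ IsAcyclic Ha ∧ Covers H₁ Ha ∧ Covers Ha H₂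

/-- `X` is `[W]`-adjacent to `Y` in `H`. -/
def AdjAvoiding {α : Type} (H : Hypergraph α) (W : Set α) (X Y : α) : Prop :=
  ∃ e ∈ H.edgeSet, X ∈ e \ W ∧ Y ∈ e \ W

/-- The `[W]`-component of `H` in which `Y` occurs (for a node `Y` outside `W`): the nodes outside
`W` that are linked to `Y` by a sequence of `[W]`-adjacent nodes. -/
def component {α : Type} (H : Hypergraph α) (W : Set α) (Y : α) : Set α :=
  {Z | Z ∈ H.vertexSet \ W ∧ Relation.ReflTransGen (AdjAvoiding H W) Y Z}

open Classical in
/-- The frontier of `Y` w.r.t. `W` in `H`: empty if `Y ∈ W`, and otherwise the set of the elements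
of `W` in hyperedges that meet the `[W]`-component of `Y`. -/
noncomputable def frontier {α : Type} (Y : α) (W : Set α) (H : Hypergraph α) : Set α :=
  if Y ∈ W then ∅
  else W ∩ ⋃₀ {e | e ∈ H.edgeSet ∧ (e ∩ component H W Y).Nonempty}

/-- The frontier hypergraph of a query with hypergraph `H` w.r.t. `W`. Its hyperedges are the
frontiers of the nodes of `H` and the hyperedges of `H` that are contained in `W`. -/
noncomputable def frontierHypergraph {α : Type} (H : Hypergraph α) (W : Set α) : Hypergraph α where
  vertexSet := H.vertexSet ∪ W
  edgeSet := {e | ∃ Y ∈ H.vertexSet, e = frontier Y W H} ∪ {e | e ∈ H.edgeSet ∧ e ⊆ W}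
  subset_vertexSet_of_mem_edgeSet' := by
    rintro e (⟨Y, -, rfl⟩ | ⟨-, h⟩)
    · unfold frontier
      split_ifs
      · exact Set.empty_subset _
      · exact Set.inter_subset_left.trans Set.subset_union_right
    · exact h.trans Set.subset_union_right

/-- `Ha` is a #-decomposition of `Q` w.r.t. `V`: for some core `Q'` of `color(Q)`, it is a tree
projection of the hypergraph of `Q'` w.r.t. the hypergraph of `V`, and it covers the frontier
hypergraph of `Q'` w.r.t. the free variables of `Q`. -/
def IsSharpDecomposition (Ha : Hypergraph ℕ) (Q : Query ℕ) (V : List (Atom ℕ)) : Prop :=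
  ∃ Q' : Set (Atom (ℕ ⊕ ℕ)), IsCore Q' Q.color.atomSet ∧
    IsTreeProjection Ha (hypergraphOf Q') (hypergraphOf {w | w ∈ V}) ∧
    Covers (frontierHypergraph (hypergraphOf Q') Q.free) Ha

/-! ## Machine model

The WHILE language over binary trees, a standard model of computation, with a running time
that charges every evaluation of an expression for the sizes of the values of all its
subexpressions. A run of cost `t` is simulated by a Turing machine in time polynomial in
`t` and the input size, and conversely. -/

/-- Data values: binary trees. -/
inductive Data where
  | nil
  | cons (l r : Data)
  deriving DecidableEq

namespace Data

/-- The number of nodes, leaves included. -/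
def size : Data → ℕ
  | nil => 1
  | cons l r => 1 + l.size + r.size

/-- Left subtree. -/
def hd : Data → Data
  | nil => nil
  | cons l _ => l

/-- Right subtree. -/
def tl : Data → Data
  | nil => nil
  | cons _ r => r

/-- Truth values. The trees other than `nil` count as true. -/
def ofBool : Bool → Data
  | false => nil
  | true => cons nil nil

/-- Lists. -/
def ofList {α : Type} (enc : α → Data) : List α → Data
  | [] => nil
  | a :: l => cons (enc a) (ofList enc l)

/-- Natural numbers, in binary. -/
def ofNat (n : ℕ) : Data := ofList ofBool n.bits

end Data

/-- A store assigns a value to each register. -/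
abbrev Store := ℕ → Data

/-- Expressions. -/
inductive Expr where
  | reg (i : ℕ)
  | nil
  | cons (a b : Expr)
  | hd (a : Expr)
  | tl (a : Expr)
  | eq (a b : Expr)

namespace Expr

/-- The value of an expression. -/
def eval (s : Store) : Expr → Data
  | reg i => s i
  | nil => .nil
  | cons a b => .cons (a.eval s) (b.eval s)
  | hd a => (a.eval s).hd
  | tl a => (a.eval s).tl
  | eq a b => .ofBool (decide (a.eval s = b.eval s))

/-- The cost of evaluating an expression: the sum of the sizes of the values of all its
subexpressions. -/
def cost (s : Store) : Expr → ℕ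
  | reg i => (s i).size
  | nil => 1
  | cons a b => a.cost s + b.cost s + ((cons a b).eval s).size
  | hd a => a.cost s + ((hd a).eval s).size
  | tl a => a.cost s + ((tl a).eval s).size
  | eq a b => a.cost s + b.cost s + ((eq a b).eval s).size

end Expr

/-- Programs. -/
inductive Prog where
  | skip
  | assign (i : ℕ) (e : Expr)
  | seq (p q : Prog)
  | ite (e : Expr) (p q : Prog)
  | while (e : Expr) (p : Prog)

/-- `Run p s s' t`: program `p`, started in the store `s`, halts in the store `s'` after
time `t`. -/
inductive Run : Prog → Store → Store → ℕ → Prop where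
  | skip (s : Store) : Run .skip s s 1
  | assign (i : ℕ) (e : Expr) (s : Store) :
      Run (.assign i e) s (Function.update s i (e.eval s)) (1 + e.cost s)
  | seq {p q : Prog} {s₁ s₂ s₃ : Store} {t u : ℕ} (hp : Run p s₁ s₂ t) (hq : Run q s₂ s₃ u) :
      Run (.seq p q) s₁ s₃ (t + u)
  | ite_true {e : Expr} {p q : Prog} {s s' : Store} {t : ℕ} (he : e.eval s ≠ .nil)
      (hp : Run p s s' t) : Run (.ite e p q) s s' (1 + e.cost s + t)
  | ite_false {e : Expr} {p q : Prog} {s s' : Store} {t : ℕ} (he : e.eval s = .nil)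
      (hq : Run q s s' t) : Run (.ite e p q) s s' (1 + e.cost s + t)
  | while_true {e : Expr} {p : Prog} {s₁ s₂ s₃ : Store} {t u : ℕ} (he : e.eval s₁ ≠ .nil)
      (hp : Run p s₁ s₂ t) (hw : Run (.while e p) s₂ s₃ u) :
      Run (.while e p) s₁ s₃ (1 + e.cost s₁ + t + u)
  | while_false {e : Expr} {p : Prog} {s : Store} (he : e.eval s = .nil) :
      Run (.while e p) s s (1 + e.cost s)

/-- On input `x`, program `p` halts with output `y` after time `t`. Input and output are in
register `0`; the other registers are initially `nil`. -/
def Computes (p : Prog) (x y : Data) (t : ℕ) : Prop :=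
  ∃ s : Store, Run p (Function.update (fun _ => Data.nil) 0 x) s t ∧ s 0 = y

/-- A problem with instances in `I`, encoded by `enc` and parameterized by `param`, in which the
output `y` on instance `x` has to satisfy `Correct x y`, is fixed-parameter tractable: a single
program, on every instance `x`, halts with a correct output in time
`f (param x) * |x| ^ c`, for a computable function `f` and a constant `c`. -/
def FixedParameterTractable {I : Type} (enc : I → Data) (param : I → ℕ)
    (Correct : I → Data → Prop) : Prop :=
  ∃ (p : Prog) (f : ℕ → ℕ) (c : ℕ), Computable f ∧
    ∀ x : I, ∃ (y : Data) (t : ℕ),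
      Computes p (enc x) y t ∧ t ≤ f (param x) * (enc x).size ^ c ∧ Correct x y

/-! ## The problem -/

/-- An instance: a query and a view set for it. -/
structure Instance where
  query : Query ℕ
  views : List (Atom ℕ)
  isViewSet : IsViewSet views query

/-- Encoding of terms. -/
def Term.encode : Term → Data
  | .var X => .cons (.ofBool false) (.ofNat X)
  | .const c => .cons (.ofBool true) (.ofNat c)

/-- Encoding of atoms. -/
def Atom.encode (a : Atom ℕ) : Data := .cons (.ofNat a.rel) (.ofList Term.encode a.args)

/-- Encoding of queries. -/
def Query.encode (Q : Query ℕ) : Data :=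
  .cons (.ofList Atom.encode Q.atoms) (.ofList Data.ofNat Q.quantified)

/-- Encoding of instances. -/
def Instance.encode (x : Instance) : Data :=
  .cons x.query.encode (.ofList Atom.encode x.views)

/-- The parameter: the size of the query. -/
def Instance.param (x : Instance) : ℕ := x.query.size

/-- `y` encodes the hypergraph `H` by a list of its nodes and a list of its hyperedges, each of
them given as a list of nodes. -/
def EncodesHypergraph (y : Data) (H : Hypergraph ℕ) : Prop :=
  ∃ (nodes : List ℕ) (edges : List (List ℕ)),
    y = .cons (.ofList Data.ofNat nodes) (.ofList (Data.ofList Data.ofNat) edges) ∧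
    H.vertexSet = {X | X ∈ nodes} ∧ H.edgeSet = {e | ∃ l ∈ edges, e = {X | X ∈ l}}

/-- Correct outputs: if there is a #-decomposition, then (the encoding of) one; if there is none,
then `nil`, the answer "no" (which encodes no hypergraph). -/
def Instance.CorrectOutput (x : Instance) (y : Data) : Prop :=
  ((∃ H, IsSharpDecomposition H x.query x.views) →
    ∃ H, IsSharpDecomposition H x.query x.views ∧ EncodesHypergraph y H) ∧
  ((¬ ∃ H, IsSharpDecomposition H x.query x.views) → y = .nil)

end SharpDec

/-!
Existence of a #-decomposition depends on the views only through the traces of the views on the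
variables of the query, so an instance can be shrunk in polynomial time to a *kernel* whose size is
bounded in terms of the query size: the distinct atoms, the free variables, and the distinct traces
(`kernelOf`, `wt_kernelOf_le`). On the kernel an exhaustive search is affordable
(`Kernel.solve`). Three observations make this search both finite and elementary.

* Cores need not be computed. A core is the image of an endomorphism of the coloring, and every
  image of an endomorphism contains a core, whose hypergraph and frontiers are covered by those of
  the image; so one may search for an endomorphism instead (`exists_core_iff_exists_hom`).
* A finite hypergraph is acyclic iff its hyperedges can be listed with the running intersection
  property: the leaves of a join tree are removed one by one, or attached one by one
  (`IsAcyclic.exists_runningIntersection`, `RunningIntersection.isAcyclic`). This property survives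
  the restriction to the variables of the query and the removal of duplicates, so it is enough to
  search lists, of bounded length, of sets of variables of the query.
* A frontier is contained in a set iff some set closed under adjacency witnesses it
  (`frontier_subset_iff`), so components need not be computed either.

Correctness of the search is `Kernel.isSharpDecomposition_of_check` and `Kernel.exists_check`.

For the running time, names are kept as they are and are measured separately. An object has a
weight, for which a name counts as one node, and a bound `L` for the length of its names. The
functions that are computed in time `T (weight) * (L + 1) ^ c`, with `T` in a given class of
bounds, are closed under composition, case distinction, and iteration over lists with accumulators
of bounded weight (`Cmp`, `Cmp.foldr_of_bound`). If `T` may be primitive recursive, then iteration needs no bound for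
the accumulator, since iterating a primitive recursive bound gives another one (`Cmp.foldr`). So the
kernel is computed with a polynomial `T`, and the search with a primitive recursive `T`, whose
argument, the weight of the kernel, is bounded in terms of the query size.
-/

namespace SharpDec

/-! ### Running programs as subroutines -/

/-- Started in any store with `x` in register `0`, the program `p` halts within time `t` with `y`
in register `0`. The registers above `m` keep their values; nothing is assumed or asserted about
the registers `1, …, m`. -/
def Maps (p : Prog) (m : ℕ) (x y : Data) (t : ℕ) : Prop :=
  ∀ s : Store, s 0 = x →
    ∃ s' u, Run p s s' u ∧ s' 0 = y ∧ (∀ i, m < i → s' i = s i) ∧ u ≤ t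

theorem Data.one_le_size (d : Data) : 1 ≤ d.size := by
  cases d <;> simp only [Data.size] <;> omega

theorem Data.size_hd_le (d : Data) : d.hd.size ≤ d.size := by
  cases d <;> simp only [Data.size, Data.hd] <;> omega

theorem Data.size_tl_le (d : Data) : d.tl.size ≤ d.size := by
  cases d <;> simp only [Data.size, Data.tl] <;> omega

theorem Data.size_ofBool_le (b : Bool) : (Data.ofBool b).size ≤ 3 := by
  cases b <;> simp [Data.ofBool, Data.size]

namespace Maps

theorem mono {p : Prog} {m m' : ℕ} {x y : Data} {t t' : ℕ} (h : Maps p m x y t) (hm : m ≤ m')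
    (ht : t ≤ t') : Maps p m' x y t' := by
  intro s hs
  obtain ⟨s', u, hr, h0, hi, hu⟩ := h s hs
  exact ⟨s', u, hr, h0, fun i hi' => hi i (hm.trans_lt hi'), hu.trans ht⟩

theorem seq {p q : Prog} {m : ℕ} {x y z : Data} {t u : ℕ} (hp : Maps p m x y t)
    (hq : Maps q m y z u) : Maps (.seq p q) m x z (t + u) := by
  intro s hs
  obtain ⟨s₁, t₁, hr₁, h₁, hi₁, ht₁⟩ := hp s hs
  obtain ⟨s₂, t₂, hr₂, h₂, hi₂, ht₂⟩ := hq s₁ h₁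
  exact ⟨s₂, _, .seq hr₁ hr₂, h₂, fun i hi => (hi₂ i hi).trans (hi₁ i hi), by omega⟩

theorem assign {e : Expr} {x y : Data} {t : ℕ} (hy : ∀ s : Store, s 0 = x → e.eval s = y)
    (ht : ∀ s : Store, s 0 = x → 1 + e.cost s ≤ t) : Maps (.assign 0 e) 0 x y t := by
  intro s hs
  refine ⟨_, _, .assign 0 e s, by simp [hy s hs], ?_, ht s hs⟩
  intro i hi
  simp [Function.update_of_ne hi.ne']

theorem hd (x : Data) : Maps (.assign 0 (.hd (.reg 0))) 0 x x.hd (1 + 2 * x.size) := by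
  apply assign
  · rintro s rfl; rfl
  · rintro s rfl
    have := (s 0).size_hd_le
    simp only [Expr.cost, Expr.eval]
    omega

theorem tl (x : Data) : Maps (.assign 0 (.tl (.reg 0))) 0 x x.tl (1 + 2 * x.size) := by
  apply assign
  · rintro s rfl; rfl
  · rintro s rfl
    have := (s 0).size_tl_le
    simp only [Expr.cost, Expr.eval]
    omega

theorem eq (x : Data) : Maps (.assign 0 (.eq (.hd (.reg 0)) (.tl (.reg 0)))) 0 x
    (.ofBool (decide (x.hd = x.tl))) (4 + 4 * x.size) := by
  apply assign
  · rintro s rfl; rfl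
  · rintro s rfl
    have h₁ := (s 0).size_hd_le
    have h₂ := (s 0).size_tl_le
    have h₃ := Data.size_ofBool_le
      (decide ((Expr.hd (.reg 0)).eval s = (Expr.tl (.reg 0)).eval s))
    simp only [Expr.cost, Expr.eval] at h₃ ⊢
    omega

/-- The closed expression with value `d`. -/
def quote : Data → Expr
  | .nil => .nil
  | .cons l r => .cons (quote l) (quote r)

theorem eval_quote (s : Store) (d : Data) : (quote d).eval s = d := by
  induction d with
  | nil => rfl
  | cons l r hl hr => simp [quote, Expr.eval, hl, hr]

theorem const (d : Data) : ∃ t, ∀ x, Maps (.assign 0 (quote d)) 0 x d t := by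
  have hc : ∃ t, ∀ s, (quote d).cost s ≤ t := by
    induction d with
    | nil => exact ⟨1, fun s => le_rfl⟩
    | cons l r hl hr =>
      obtain ⟨t, ht⟩ := hl
      obtain ⟨u, hu⟩ := hr
      refine ⟨t + u + (1 + l.size + r.size), fun s => ?_⟩
      have := ht s
      have := hu s
      simp only [quote, Expr.cost, Expr.eval, eval_quote, Data.size]
      omega
  obtain ⟨t, ht⟩ := hc
  exact ⟨1 + t, fun x => assign (fun s _ => eval_quote s d) fun s _ => by have := ht s; omega⟩

/-- Run `p` and `q` on the same input. -/
def pairProg (m : ℕ) (p q : Prog) : Prog :=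
  .seq (.assign (m + 1) (.reg 0)) <| .seq p <| .seq (.assign (m + 2) (.reg 0)) <|
    .seq (.assign 0 (.reg (m + 1))) <| .seq q (.assign 0 (.cons (.reg (m + 2)) (.reg 0)))

theorem pair {p q : Prog} {m : ℕ} {x y z : Data} {t u : ℕ} (hp : Maps p m x y t)
    (hq : Maps q m x z u) :
    Maps (pairProg m p q) (m + 2) x (.cons y z)
      (6 + t + u + 2 * x.size + 3 * y.size + 2 * z.size) := by
  intro s hs
  obtain ⟨s₁, t₁, hr₁, h₁, hi₁, ht₁⟩ := hp (Function.update s (m + 1) x) (by simp [hs])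
  obtain ⟨s₂, t₂, hr₂, h₂, hi₂, ht₂⟩ := hq
    (Function.update (Function.update s₁ (m + 2) y) 0 x) (by simp)
  have e₁ : s₁ (m + 1) = x := by rw [hi₁ _ (by omega)]; simp
  have e₂ : s₂ (m + 2) = y := by rw [hi₂ _ (by omega)]; simp
  have r₁ : Run p (Function.update s (m + 1) ((Expr.reg 0).eval s)) s₁ t₁ := by
    simpa [Expr.eval, hs] using hr₁
  have r₂ : Run q (Function.update (Function.update s₁ (m + 2) ((Expr.reg 0).eval s₁)) 0
      ((Expr.reg (m + 1)).eval (Function.update s₁ (m + 2) ((Expr.reg 0).eval s₁)))) s₂ t₂ := by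
    simpa [Expr.eval, h₁, e₁] using hr₂
  refine ⟨_, _, .seq (.assign _ _ _) (.seq r₁ (.seq (.assign _ _ _)
    (.seq (.assign _ _ _) (.seq r₂ (.assign _ _ _))))), by simp [Expr.eval, e₂, h₂], ?_, ?_⟩
  · intro i hi
    rw [Function.update_of_ne (by omega), hi₂ i (by omega), Function.update_of_ne (by omega),
      Function.update_of_ne (by omega), hi₁ i (by omega), Function.update_of_ne (by omega)]
  · simp only [Expr.cost, Expr.eval, hs, h₁, h₂, e₂, Data.size]
    rw [Function.update_of_ne (by omega : m + 1 ≠ m + 2), e₁]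
    omega

/-- Run `p` on the input, and then `q` or `r` on the same input. -/
def iteProg (m : ℕ) (p q r : Prog) : Prog :=
  .seq (.assign (m + 1) (.reg 0)) <| .seq p <|
    .ite (.reg 0) (.seq (.assign 0 (.reg (m + 1))) q) (.seq (.assign 0 (.reg (m + 1))) r)

theorem ite {p q r : Prog} {m : ℕ} {x y z : Data} {b : Bool} {t u v : ℕ}
    (hp : Maps p m x (.ofBool b) t) (hq : Maps q m x y u) (hr : Maps r m x z v) :
    Maps (iteProg m p q r) (m + 1) x (bif b then y else z) (6 + t + u + v + 2 * x.size) := by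
  intro s hs
  obtain ⟨s₁, t₁, hr₁, h₁, hi₁, ht₁⟩ := hp (Function.update s (m + 1) x) (by simp [hs])
  have e₁ : s₁ (m + 1) = x := by rw [hi₁ _ (by omega)]; simp
  have hb := Data.size_ofBool_le b
  have hrun : Run p (Function.update s (m + 1) (Expr.eval s (.reg 0))) s₁ t₁ := by
    simpa [Expr.eval, hs] using hr₁
  have main : ∀ {q' : Prog} {y' : Data} {u' : ℕ}, Maps q' m x y' u' →
      ∃ s' u'', Run (.seq (.assign 0 (.reg (m + 1))) q') s₁ s' u'' ∧ s' 0 = y' ∧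
        (∀ i, m + 1 < i → s' i = s i) ∧ u'' ≤ 1 + x.size + u' := by
    intro q' y' u' hq'
    obtain ⟨s₂, t₂, hr₂, h₂, hi₂, ht₂⟩ := hq' (Function.update s₁ 0 x) (by simp)
    refine ⟨s₂, 1 + x.size + t₂, .seq ?_ hr₂, h₂, fun i hi => ?_, by omega⟩
    · have := Run.assign 0 (.reg (m + 1)) s₁
      simpa [Expr.eval, Expr.cost, e₁] using this
    · rw [hi₂ i (by omega), Function.update_of_ne (by omega), hi₁ i (by omega),
        Function.update_of_ne (by omega)]
  cases b with
  | false =>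
    obtain ⟨s₂, t₂, hr₂, h₂, hi₂, ht₂⟩ := main hr
    refine ⟨s₂, _, .seq (.assign _ _ _) (.seq hrun (.ite_false ?_ hr₂)), h₂, hi₂, ?_⟩
    · simpa [Expr.eval, Data.ofBool] using h₁
    · simp only [Expr.cost, hs, h₁]
      omega
  | true =>
    obtain ⟨s₂, t₂, hr₂, h₂, hi₂, ht₂⟩ := main hq
    refine ⟨s₂, _, .seq (.assign _ _ _) (.seq hrun (.ite_true ?_ hr₂)), h₂, hi₂, ?_⟩
    · simp [Expr.eval, h₁, Data.ofBool]
    · simp only [Expr.cost, hs, h₁]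
      omega

/-- Pass the elements of the list in register `m + 2` to `p`, together with the datum in
register `m + 1` and the current value of the accumulator in register `m + 3`. -/
def loopProg (m : ℕ) (p : Prog) : Prog :=
  .while (.reg (m + 2)) <|
    .seq (.assign 0 (.cons (.reg (m + 1)) (.cons (.hd (.reg (m + 2))) (.reg (m + 3))))) <|
    .seq p <| .seq (.assign (m + 3) (.reg 0)) (.assign (m + 2) (.tl (.reg (m + 2))))

/-- The loop computes a left fold. `N` bounds the sizes of the values that occur, and `u` the time
of a call of `p`; the constants are generous. -/
theorem run_loopProg {α β : Type} (ea : α → Data) (eb : β → Data) (f : β → α → β) {p : Prog}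
    {m : ℕ} {c : Data} {u N : ℕ} (hc : c.size ≤ N) (l : List α) :
    ∀ (b : β) (_ : (Data.ofList ea l).size ≤ N)
      (_ : ∀ l₁, l₁ <+: l → (eb (l₁.foldl f b)).size ≤ N)
      (_ : ∀ l₁ a, l₁ ++ [a] <+: l →
        Maps p m (.cons c (.cons (ea a) (eb (l₁.foldl f b)))) (eb (f (l₁.foldl f b) a)) u)
      (s : Store) (_ : s (m + 1) = c) (_ : s (m + 2) = Data.ofList ea l) (_ : s (m + 3) = eb b),
      ∃ s' t, Run (loopProg m p) s s' t ∧ s' (m + 3) = eb (l.foldl f b) ∧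
        (∀ i, m + 3 < i → s' i = s i) ∧ t ≤ (l.length + 1) * (u + 20 * N + 20) := by
  induction l with
  | nil =>
    intro b hl _ _ s _ h₂ h₃
    refine ⟨s, _, .while_false (by simpa [Expr.eval, Data.ofList] using h₂), h₃,
      fun _ _ => rfl, ?_⟩
    simp only [Expr.cost, h₂, List.length_nil]
    omega
  | cons a l ih =>
    intro b hl hb hp s h₁ h₂ h₃
    have hl' : 1 + (ea a).size + (Data.ofList ea l).size ≤ N := hl
    have hbN : (eb b).size ≤ N := hb [] (List.nil_prefix)
    have hb'N : (eb (f b a)).size ≤ N := hb [a] ⟨l, rfl⟩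
    obtain ⟨s₁, t₁, hr₁, e₁, hi₁, ht₁⟩ := hp [] a ⟨l, rfl⟩
      (Function.update s 0 (.cons c (.cons (ea a) (eb b)))) (by simp)
    simp only [List.foldl_nil] at e₁
    have f₁ : s₁ (m + 1) = c := by rw [hi₁ _ (by omega)]; simpa using h₁
    have f₂ : s₁ (m + 2) = Data.ofList ea (a :: l) := by rw [hi₁ _ (by omega)]; simpa using h₂
    set s₂ := Function.update s₁ (m + 3) (eb (f b a)) with hs₂
    set s₃ := Function.update s₂ (m + 2) (Data.ofList ea l) with hs₃
    obtain ⟨s', t, hr, e', hi', ht⟩ := ih (f b a) (by omega)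
      (fun l₁ h => hb (a :: l₁) (by simpa using h))
      (fun l₁ a' h => hp (a :: l₁) a' (by simpa using h)) s₃
      (by simp [hs₃, hs₂, f₁]) (by simp [hs₃]) (by simp [hs₃, hs₂])
    refine ⟨s', _, .while_true ?_ (.seq (.assign _ _ _) (.seq (s₂ := s₁) (t := t₁) ?_
      (.seq (s₂ := s₂) (t := 1 + (eb (f b a)).size) ?_
        (s₃ := s₃) (u := 1 + ((Data.ofList ea (a :: l)).size + (Data.ofList ea l).size)) ?_))) hr,
        e', ?_, ?_⟩
    · simp [Expr.eval, h₂, Data.ofList]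
    · simpa [Expr.eval, h₁, h₂, h₃, Data.ofList, Data.hd] using hr₁
    · have := Run.assign (m + 3) (.reg 0) s₁
      simpa [Expr.eval, Expr.cost, e₁] using this
    · have := Run.assign (m + 2) (.tl (.reg (m + 2))) s₂
      have f₃ : s₂ (m + 2) = Data.ofList ea (a :: l) := by simpa [hs₂] using f₂
      simpa [Expr.eval, Expr.cost, f₃, Data.ofList, Data.tl] using this
    · intro i hi
      rw [hi' i hi, hs₃, Function.update_of_ne (by omega), hs₂, Function.update_of_ne (by omega),
        hi₁ i (by omega), Function.update_of_ne (by omega)]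
    · simp only [Expr.cost, Expr.eval, h₁, h₂, h₃, Data.ofList, Data.size, Data.hd,
        List.length_cons]
      rw [add_mul (l.length + 1) 1]
      omega

/-- Fold the program `p` over a list. The input consists of a datum that is passed to each call
of `p`, the list, and the initial value of the accumulator. -/
def foldlProg (m : ℕ) (p : Prog) : Prog :=
  .seq (.assign (m + 1) (.hd (.reg 0))) <| .seq (.assign (m + 2) (.hd (.tl (.reg 0)))) <|
    .seq (.assign (m + 3) (.tl (.tl (.reg 0)))) <|
    .seq (loopProg m p) (.assign 0 (.reg (m + 3)))

theorem foldl {α β : Type} (ea : α → Data) (eb : β → Data) (f : β → α → β) {p : Prog}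
    {m : ℕ} {c : Data} {u N : ℕ} (l : List α) (b : β) (hc : c.size ≤ N)
    (hl : (Data.ofList ea l).size ≤ N)
    (hb : ∀ l₁, l₁ <+: l → (eb (l₁.foldl f b)).size ≤ N)
    (hp : ∀ l₁ a, l₁ ++ [a] <+: l →
      Maps p m (.cons c (.cons (ea a) (eb (l₁.foldl f b)))) (eb (f (l₁.foldl f b) a)) u) :
    Maps (foldlProg m p) (m + 3) (.cons c (.cons (Data.ofList ea l) (eb b)))
      (eb (l.foldl f b)) ((l.length + 1) * (u + 20 * N + 20) + 60 * N + 60) := by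
  intro s hs
  have hbN : (eb b).size ≤ N := hb [] (List.nil_prefix)
  have hb'N : (eb (l.foldl f b)).size ≤ N := hb l List.prefix_rfl
  obtain ⟨s', t, hr, e', hi', ht⟩ := run_loopProg ea eb f hc l b hl hb hp
    (Function.update (Function.update (Function.update s (m + 1) c)
      (m + 2) (Data.ofList ea l)) (m + 3) (eb b)) (by simp) (by simp) (by simp)
  refine ⟨Function.update s' 0 (eb (l.foldl f b)), _, .seq (.assign _ _ _) (.seq (.assign _ _ _)
    (.seq (.assign _ _ _) (.seq (s₂ := s') (t := t) ?_
      (u := 1 + (eb (l.foldl f b)).size) ?_))), by simp, ?_, ?_⟩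
  · simpa [Expr.eval, hs, Data.hd, Data.tl] using hr
  · have := Run.assign 0 (.reg (m + 3)) s'
    simpa [Expr.eval, Expr.cost, e'] using this
  · intro i hi
    rw [Function.update_of_ne (by omega), hi' i hi, Function.update_of_ne (by omega),
      Function.update_of_ne (by omega), Function.update_of_ne (by omega)]
  · simp only [Expr.cost, Expr.eval, hs, Data.hd, Data.tl, Data.size, ne_eq,
      not_false_eq_true, Function.update_of_ne, (Nat.succ_ne_zero _).symm]
    omega

end Maps

/-! ### Classes of bounds -/

/-- A class of monotone functions that is closed under the operations needed to bound the running
time of composed programs. -/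
structure BoundClass where
  mem : (ℕ → ℕ) → Prop
  monotone : ∀ {T}, mem T → Monotone T
  id : mem fun n => n
  const : ∀ k, mem fun _ => k
  add : ∀ {S T}, mem S → mem T → mem fun n => S n + T n
  mul : ∀ {S T}, mem S → mem T → mem fun n => S n * T n
  comp : ∀ {S T}, mem S → mem T → mem fun n => S (T n)

/-- The polynomially bounded monotone functions. -/
def BoundClass.poly : BoundClass where
  mem T := Monotone T ∧ ∃ c, ∀ n, T n ≤ (n + 2) ^ c
  monotone h := h.1
  id := ⟨fun _ _ h => h, 1, fun n => by simp⟩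
  const k := ⟨fun _ _ _ => le_rfl, k, fun n =>
    (Nat.lt_two_pow_self (n := k)).le.trans (Nat.pow_le_pow_left (by omega) k)⟩
  add := by
    rintro S T ⟨hS, a, ha⟩ ⟨hT, b, hb⟩
    refine ⟨fun _ _ h => add_le_add (hS h) (hT h), a + b + 1, fun n => ?_⟩
    have h₁ : (n + 2) ^ a ≤ (n + 2) ^ (a + b) := Nat.pow_le_pow_right (by omega) (by omega)
    have h₂ : (n + 2) ^ b ≤ (n + 2) ^ (a + b) := Nat.pow_le_pow_right (by omega) (by omega)
    calc S n + T n ≤ (n + 2) ^ (a + b) * 2 := by have := ha n; have := hb n; omega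
      _ ≤ (n + 2) ^ (a + b + 1) := by rw [pow_succ]; gcongr; omega
  mul := by
    rintro S T ⟨hS, a, ha⟩ ⟨hT, b, hb⟩
    exact ⟨fun _ _ h => Nat.mul_le_mul (hS h) (hT h), a + b, fun n => by
      rw [pow_add]; exact Nat.mul_le_mul (ha n) (hb n)⟩
  comp := by
    rintro S T ⟨hS, a, ha⟩ ⟨hT, b, hb⟩
    refine ⟨fun _ _ h => hS (hT h), (b + 2) * a, fun n => ?_⟩
    have h₁ : 1 ≤ (n + 2) ^ b := Nat.one_le_pow _ _ (by omega)
    have h₂ : 2 ^ 2 ≤ (n + 2) ^ 2 := Nat.pow_le_pow_left (by omega) 2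
    calc S (T n) ≤ (T n + 2) ^ a := ha _
      _ ≤ ((n + 2) ^ (b + 2)) ^ a := by
        gcongr
        rw [pow_add]
        have := hb n
        nlinarith
      _ = (n + 2) ^ ((b + 2) * a) := by rw [pow_mul]

/-- The primitive recursive monotone functions. -/
def BoundClass.primrec : BoundClass where
  mem T := Monotone T ∧ Primrec T
  monotone h := h.1
  id := ⟨fun _ _ h => h, Primrec.id⟩
  const k := ⟨fun _ _ _ => le_rfl, Primrec.const k⟩
  add h₁ h₂ := ⟨fun _ _ h => add_le_add (h₁.1 h) (h₂.1 h), Primrec.nat_add.comp h₁.2 h₂.2⟩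
  mul h₁ h₂ := ⟨fun _ _ h => Nat.mul_le_mul (h₁.1 h) (h₂.1 h), Primrec.nat_mul.comp h₁.2 h₂.2⟩
  comp h₁ h₂ := ⟨fun _ _ h => h₁.1 (h₂.1 h), h₁.2.comp h₂.2⟩

/-- A function of a weight `w` and a bound `L` for the length of names is dominated by a function
from `C` in `w` times a polynomial in `L`. -/
def Dominated (C : BoundClass) (g : ℕ → ℕ → ℕ) : Prop :=
  ∃ T, C.mem T ∧ ∃ c, ∀ w L, g w L ≤ T w * (L + 1) ^ c

namespace Dominated

variable {C : BoundClass} {g h : ℕ → ℕ → ℕ}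

theorem of_mem {T : ℕ → ℕ} (hT : C.mem T) : Dominated C fun w _ => T w :=
  ⟨T, hT, 0, fun w L => by simp⟩

theorem const (k : ℕ) : Dominated C fun _ _ => k := of_mem (C.const k)

theorem pow {T : ℕ → ℕ} (hT : C.mem T) (c : ℕ) : Dominated C fun w L => T w * (L + 1) ^ c :=
  ⟨T, hT, c, fun _ _ => le_rfl⟩

theorem size {T : ℕ → ℕ} (hT : C.mem T) : Dominated C fun w L => T w * (L + 1) := by
  simpa using pow hT 1

theorem add (hg : Dominated C g) (hh : Dominated C h) :
    Dominated C fun w L => g w L + h w L := by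
  obtain ⟨S, hS, a, ha⟩ := hg
  obtain ⟨T, hT, b, hb⟩ := hh
  refine ⟨_, C.add hS hT, a + b, fun w L => ?_⟩
  have h₁ : (L + 1) ^ a ≤ (L + 1) ^ (a + b) := Nat.pow_le_pow_right (by omega) (by omega)
  have h₂ : (L + 1) ^ b ≤ (L + 1) ^ (a + b) := Nat.pow_le_pow_right (by omega) (by omega)
  rw [add_mul]
  exact add_le_add ((ha w L).trans (Nat.mul_le_mul_left _ h₁))
    ((hb w L).trans (Nat.mul_le_mul_left _ h₂))

theorem mul (hg : Dominated C g) (hh : Dominated C h) :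
    Dominated C fun w L => g w L * h w L := by
  obtain ⟨S, hS, a, ha⟩ := hg
  obtain ⟨T, hT, b, hb⟩ := hh
  refine ⟨_, C.mul hS hT, a + b, fun w L => (Nat.mul_le_mul (ha w L) (hb w L)).trans ?_⟩
  rw [pow_add]
  exact le_of_eq (by ring)

end Dominated

/-! ### Encoded types and computable functions -/

/-- A type whose elements are encoded by data, with two measures for the size of an element:
the weight counts the nodes of the encoding, except that a name counts as a single node, and
`bd L a` says that the names in `a` have encodings of size at most `L`. -/
class Enc (α : Type) where
  enc : α → Data
  wt : α → ℕ
  bd : ℕ → α → Prop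
  enc_injective : Function.Injective enc
  size_le : ∀ {L a}, bd L a → (enc a).size ≤ wt a * (L + 1)
  wt_le : ∀ a, wt a ≤ (enc a).size
  bd_mono : ∀ {L L' a}, L ≤ L' → bd L a → bd L' a
  bd_size : ∀ a, bd (enc a).size a

open Enc

instance : Enc Bool where
  enc := Data.ofBool
  wt b := (Data.ofBool b).size
  bd _ _ := True
  enc_injective := by intro a b; cases a <;> cases b <;> simp [Data.ofBool]
  size_le := fun {L _} _ => Nat.le_mul_of_pos_right _ (by omega)
  wt_le _ := le_rfl
  bd_mono _ h := h
  bd_size _ := trivial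

theorem ofList_injective {α : Type} {e : α → Data} (he : Function.Injective e) :
    Function.Injective (Data.ofList e) := by
  intro l
  induction l with
  | nil => rintro (_ | ⟨a, l⟩) h <;> simp_all [Data.ofList]
  | cons a l ih =>
    rintro (_ | ⟨b, l'⟩) h
    · simp [Data.ofList] at h
    · simp only [Data.ofList, Data.cons.injEq] at h
      rw [he h.1, ih h.2]

theorem ofNat_injective : Function.Injective Data.ofNat := by
  intro m n h
  have h₁ : m.bits = n.bits := ofList_injective (enc_injective (α := Bool)) h
  have h₂ := congrArg (fun l : List Bool => l.foldr Nat.bit 0) h₁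
  have h₃ : ∀ k : ℕ, k.bits.foldr Nat.bit 0 = k := by
    intro k
    induction k using Nat.binaryRec' with
    | zero => simp
    | bit b k hk ih => rw [Nat.bits_append_bit _ _ hk]; simp [ih]
  simpa [h₃] using h₂

/-- The numbers are the names. -/
instance : Enc ℕ where
  enc := Data.ofNat
  wt _ := 1
  bd L n := (Data.ofNat n).size ≤ L
  enc_injective := ofNat_injective
  size_le h := by omega
  wt_le n := (Data.ofNat n).one_le_size
  bd_mono h h' := h'.trans h
  bd_size _ := le_rfl

/-- Pairs are encoded as by `Query.encode` and `Instance.encode`. -/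
instance {α β : Type} [Enc α] [Enc β] : Enc (α × β) where
  enc x := .cons (enc x.1) (enc x.2)
  wt x := 1 + wt x.1 + wt x.2
  bd L x := bd L x.1 ∧ bd L x.2
  enc_injective := by
    rintro ⟨a, b⟩ ⟨a', b'⟩ h
    simp only [Data.cons.injEq] at h
    rw [enc_injective h.1, enc_injective h.2]
  size_le := by
    rintro L ⟨a, b⟩ ⟨ha, hb⟩
    have h₁ := size_le ha
    have h₂ := size_le hb
    simp only [Data.size, add_mul] at h₁ h₂ ⊢
    omega
  wt_le x := by
    have h₁ := wt_le x.1
    have h₂ := wt_le x.2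
    simp only [Data.size]
    omega
  bd_mono h h' := ⟨bd_mono h h'.1, bd_mono h h'.2⟩
  bd_size x := ⟨bd_mono (by simp only [Data.size]; omega) (bd_size x.1),
    bd_mono (by simp only [Data.size]; omega) (bd_size x.2)⟩

instance {α : Type} [Enc α] : Enc (List α) where
  enc := Data.ofList enc
  wt l := 1 + (l.map fun a => 1 + wt a).sum
  bd L l := ∀ a ∈ l, bd L a
  enc_injective := ofList_injective enc_injective
  size_le := by
    intro L l h
    induction l with
    | nil => simp [Data.ofList, Data.size]
    | cons a l ih =>
      have h₁ := size_le (h a (by simp))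
      have h₂ := ih fun b hb => h b (by simp [hb])
      simp only [Data.ofList, Data.size, List.map_cons, List.sum_cons, add_mul] at h₁ h₂ ⊢
      omega
  wt_le l := by
    induction l with
    | nil => simp [Data.ofList, Data.size]
    | cons a l ih =>
      have h₁ := wt_le a
      simp only [Data.ofList, Data.size, List.map_cons, List.sum_cons] at ih ⊢
      omega
  bd_mono h h' a ha := bd_mono h (h' a ha)
  bd_size l := by
    induction l with
    | nil => simp
    | cons a l ih =>
      intro b hb
      simp only [Data.ofList, Data.size]
      rcases List.mem_cons.1 hb with rfl | hb
      · exact bd_mono (by omega) (bd_size b)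
      · exact bd_mono (by omega) (ih b hb)

section weights

variable {α β : Type} [Enc α] [Enc β]

theorem wt_mk (a : α) (b : β) : wt (a, b) = 1 + wt a + wt b := rfl

theorem wt_prod (x : α × β) : wt x = 1 + wt x.1 + wt x.2 := rfl

theorem wt_nil : wt ([] : List α) = 1 := rfl

theorem wt_list (l : List α) : wt l = 1 + (l.map fun a => 1 + wt a).sum := rfl

theorem wt_cons (a : α) (l : List α) : wt (a :: l) = 1 + wt a + wt l := by
  simp only [wt_list, List.map_cons, List.sum_cons]
  omega

theorem wt_append (l l' : List α) : wt (l ++ l') + 1 = wt l + wt l' := by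
  simp only [wt_list, List.map_append, List.sum_append]
  omega

theorem wt_reverse (l : List α) : wt l.reverse = wt l := by
  simp [wt_list, List.sum_reverse]

theorem wt_sublist {l l' : List α} (h : l.Sublist l') : wt l ≤ wt l' := by
  have := (h.map fun a => 1 + wt a).sum_le_sum (by simp)
  simp only [wt_list]
  omega

theorem wt_le_of_mem {a : α} {l : List α} (h : a ∈ l) : wt a ≤ wt l := by
  have := List.single_le_sum (l := l.map fun a => 1 + wt a) (by simp) (1 + wt a)
    (List.mem_map_of_mem h)
  simp only [wt_list]
  omega

theorem length_lt_wt (l : List α) : l.length < wt l := by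
  induction l with
  | nil => simp [wt_nil]
  | cons a l ih => simp only [wt_cons, List.length_cons]; omega

theorem wt_list_le {l : List α} {k : ℕ} (h : ∀ a ∈ l, wt a ≤ k) :
    wt l ≤ 1 + l.length * (1 + k) := by
  have := List.sum_le_card_nsmul (l.map fun a => 1 + wt a) (1 + k) (by
    intro x hx
    obtain ⟨a, ha, rfl⟩ := List.mem_map.1 hx
    have := h a ha
    omega)
  simp only [wt_list, List.length_map, smul_eq_mul] at this ⊢
  omega

end weights

/-- The function `f` is computed by a program whose running time is bounded by a function from `C`
in the weight times a polynomial in the length of names. In addition the weight of the value is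
bounded by a function from `C`, and the value has no longer names than the argument. -/
def Cmp (C : BoundClass) {α β : Type} [Enc α] [Enc β] (f : α → β) : Prop :=
  ∃ (p : Prog) (m : ℕ) (T : ℕ → ℕ) (c : ℕ), C.mem T ∧ (∀ a, wt (f a) ≤ T (wt a)) ∧
    (∀ L a, bd L a → bd L (f a)) ∧
    ∀ L a, bd L a → Maps p m (enc a) (enc (f a)) (T (wt a) * (L + 1) ^ c)

namespace Cmp

variable {C : BoundClass} {α β γ δ : Type} [Enc α] [Enc β] [Enc γ] [Enc δ]

/-- The bounds for the weight and for the time may be given separately. -/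
theorem intro {f : α → β} (p : Prog) (m : ℕ) {T : ℕ → ℕ} {g : ℕ → ℕ → ℕ} (hT : C.mem T)
    (hg : Dominated C g) (hw : ∀ a, wt (f a) ≤ T (wt a)) (hb : ∀ L a, bd L a → bd L (f a))
    (h : ∀ L a, bd L a → Maps p m (enc a) (enc (f a)) (g (wt a) L)) : Cmp C f := by
  obtain ⟨S, hS, c, hc⟩ := hg
  refine ⟨p, m, _, c, C.add hT hS, fun a => (hw a).trans (by omega), hb, fun L a ha => ?_⟩
  exact (h L a ha).mono le_rfl ((hc _ _).trans (Nat.mul_le_mul_right _ (by omega)))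

theorem of_eq {f g : α → β} (hf : Cmp C f) (h : ∀ a, f a = g a) : Cmp C g := funext h ▸ hf

theorem id : Cmp C fun a : α => a :=
  intro .skip 0 C.id (.const 1) (fun _ => le_rfl) (fun _ _ h => h) fun _ _ _ s hs =>
    ⟨s, 1, .skip s, hs, fun _ _ => rfl, le_rfl⟩

theorem const (b : β) (hb : ∀ L, bd L b) : Cmp C fun _ : α => b := by
  obtain ⟨t, ht⟩ := Maps.const (enc b)
  exact intro _ 0 (C.const (wt b)) (.const t) (fun _ => le_rfl) (fun L _ _ => hb L)
    fun _ a _ => ht _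

theorem comp {g : β → γ} {f : α → β} (hg : Cmp C g) (hf : Cmp C f) :
    Cmp C fun a => g (f a) := by
  obtain ⟨p, m, S, c, hS, hSw, hSb, hSm⟩ := hf
  obtain ⟨q, n, T, d, hT, hTw, hTb, hTm⟩ := hg
  refine intro (.seq p q) (max m n) (C.comp hT hS)
    ((Dominated.pow hS c).add (.pow (C.comp hT hS) d))
    (fun a => (hTw _).trans (C.monotone hT (hSw a))) (fun L a h => hTb L _ (hSb L a h)) ?_
  intro L a h
  refine ((hSm L a h).mono (le_max_left _ _) le_rfl).seq
    ((hTm L _ (hSb L a h)).mono (le_max_right _ _) ?_)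
  exact Nat.mul_le_mul_right _ (C.monotone hT (hSw a))

theorem pair {f : α → β} {g : α → γ} (hf : Cmp C f) (hg : Cmp C g) :
    Cmp C fun a => (f a, g a) := by
  obtain ⟨p, m, S, c, hS, hSw, hSb, hSm⟩ := hf
  obtain ⟨q, n, T, d, hT, hTw, hTb, hTm⟩ := hg
  refine intro (Maps.pairProg (max m n) p q) (max m n + 2) (C.add (C.add (C.const 1) hS) hT)
    (((((Dominated.const 6).add (.pow hS c)).add (.pow hT d)).add
      ((Dominated.const 2).mul (.size C.id))).add ((Dominated.const 3).mul (.size hS)) |>.add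
      ((Dominated.const 2).mul (.size hT)))
    (fun a => ?_) (fun L a h => ⟨hSb L a h, hTb L a h⟩) ?_
  · have h₁ := hSw a
    have h₂ := hTw a
    simp only [wt_mk]
    omega
  · intro L a h
    refine (Maps.pair ((hSm L a h).mono (le_max_left _ _) le_rfl)
      ((hTm L a h).mono (le_max_right _ _) le_rfl)).mono le_rfl ?_
    have h₁ := size_le h
    have h₂ := (size_le (hSb L a h)).trans (Nat.mul_le_mul_right _ (hSw a))
    have h₃ := (size_le (hTb L a h)).trans (Nat.mul_le_mul_right _ (hTw a))
    omega

/-- A function that takes the left subtree of the encoding. -/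
theorem of_hd {f : α → β} (he : ∀ a, enc (f a) = (enc a).hd) (hw : ∀ a, wt (f a) ≤ wt a)
    (hb : ∀ L a, bd L a → bd L (f a)) : Cmp C f :=
  intro _ 0 C.id ((Dominated.const 1).add ((Dominated.const 2).mul (.size C.id))) hw hb
    fun L a h => he a ▸ (Maps.hd _).mono le_rfl (by have := size_le h; omega)

/-- A function that takes the right subtree of the encoding. -/
theorem of_tl {f : α → β} (he : ∀ a, enc (f a) = (enc a).tl) (hw : ∀ a, wt (f a) ≤ wt a)
    (hb : ∀ L a, bd L a → bd L (f a)) : Cmp C f :=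
  intro _ 0 C.id ((Dominated.const 1).add ((Dominated.const 2).mul (.size C.id))) hw hb
    fun L a h => he a ▸ (Maps.tl _).mono le_rfl (by have := size_le h; omega)

/-- A function that leaves the encoding as it is. -/
theorem of_enc_eq {f : α → β} (he : ∀ a, enc (f a) = enc a) {k : ℕ}
    (hw : ∀ a, wt (f a) ≤ wt a + k) (hb : ∀ L a, bd L a → bd L (f a)) : Cmp C f :=
  intro .skip 0 (C.add C.id (C.const k)) (.const 1) hw hb fun _ a _ s hs =>
    ⟨s, 1, .skip s, hs.trans (he a).symm, fun _ _ => rfl, le_rfl⟩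

theorem fst {f : α → β × γ} (hf : Cmp C f) : Cmp C fun a => (f a).1 :=
  comp (g := Prod.fst) (of_hd (fun _ => rfl) (fun x => by rw [wt_prod]; omega)
    fun L x (h : bd L x.1 ∧ bd L x.2) => h.1) hf

theorem snd {f : α → β × γ} (hf : Cmp C f) : Cmp C fun a => (f a).2 :=
  comp (g := Prod.snd) (of_tl (fun _ => rfl) (fun x => by rw [wt_prod]; omega)
    fun L x (h : bd L x.1 ∧ bd L x.2) => h.2) hf

theorem wt_bool_le (b : Bool) : wt b ≤ 3 := Data.size_ofBool_le b

theorem beq [DecidableEq β] {f g : α → β} (hf : Cmp C f) (hg : Cmp C g) :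
    Cmp C fun a => decide (f a = g a) := by
  refine comp (g := fun x : β × β => decide (x.1 = x.2)) ?_ (pair hf hg)
  refine intro (.assign 0 (.eq (.hd (.reg 0)) (.tl (.reg 0)))) 0 (C.const 3)
    ((Dominated.const 4).add ((Dominated.const 4).mul (.size C.id)))
    (fun _ => wt_bool_le _) (fun _ _ _ => trivial) fun L a h => ?_
  have he : enc (decide (a.1 = a.2)) = .ofBool (decide ((enc a).hd = (enc a).tl)) := by
    change Data.ofBool _ = _
    congr 1
    simp [enc, Data.hd, Data.tl, enc_injective.eq_iff]
  rw [he]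
  exact (Maps.eq _).mono le_rfl (by have := size_le h; omega)

theorem cond {b : α → Bool} {f g : α → β} (hb : Cmp C b) (hf : Cmp C f) (hg : Cmp C g) :
    Cmp C fun a => bif b a then f a else g a := by
  obtain ⟨r, k, R, e, hR, -, -, hRm⟩ := hb
  obtain ⟨p, m, S, c, hS, hSw, hSb, hSm⟩ := hf
  obtain ⟨q, n, T, d, hT, hTw, hTb, hTm⟩ := hg
  refine intro (Maps.iteProg (max k (max m n)) r p q) (max k (max m n) + 1) (C.add hS hT)
    (((((Dominated.const 6).add (.pow hR e)).add (.pow hS c)).add (.pow hT d)).add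
      ((Dominated.const 2).mul (.size C.id))) (fun a => ?_) (fun L a h => ?_) fun L a h => ?_
  · have h₁ := hSw a
    have h₂ := hTw a
    cases b a <;> simp only [cond_true, cond_false] <;> omega
  · cases b a
    · exact hTb L a h
    · exact hSb L a h
  · have := Maps.ite ((hRm L a h).mono (le_max_left _ _) le_rfl)
      ((hSm L a h).mono ((le_max_left _ _).trans (le_max_right _ _)) le_rfl)
      ((hTm L a h).mono ((le_max_right _ _).trans (le_max_right _ _)) le_rfl)
    rw [← Bool.apply_cond enc] at this
    exact this.mono le_rfl (by have := size_le h; omega)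

theorem ite {p : α → Prop} [DecidablePred p] {f g : α → β} (hb : Cmp C fun a => decide (p a))
    (hf : Cmp C f) (hg : Cmp C g) : Cmp C fun a => if p a then f a else g a :=
  (cond hb hf hg).of_eq fun a => by by_cases h : p a <;> simp [h]

theorem true : Cmp C fun _ : α => Bool.true := const _ fun _ => trivial

theorem false : Cmp C fun _ : α => Bool.false := const _ fun _ => trivial

theorem nil : Cmp C fun _ : α => ([] : List β) := const _ fun _ => by simp [bd]

theorem and {a b : α → Bool} (ha : Cmp C a) (hb : Cmp C b) : Cmp C fun x => a x && b x :=
  (cond ha hb false).of_eq fun x => by cases a x <;> rfl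

theorem or {a b : α → Bool} (ha : Cmp C a) (hb : Cmp C b) : Cmp C fun x => a x || b x :=
  (cond ha true hb).of_eq fun x => by cases a x <;> rfl

theorem not {a : α → Bool} (ha : Cmp C a) : Cmp C fun x => !a x :=
  (cond ha false true).of_eq fun x => by cases a x <;> rfl

theorem cons {f : α → β} {g : α → List β} (hf : Cmp C f) (hg : Cmp C g) :
    Cmp C fun a => f a :: g a := by
  refine comp (g := fun x : β × List β => x.1 :: x.2) ?_ (pair hf hg)
  refine of_enc_eq (k := 0) (fun _ => rfl) (fun x => ?_) fun L x h => ?_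
  · rw [wt_prod, wt_cons]
    omega
  · intro b hb
    rcases List.mem_cons.1 hb with rfl | hb
    · exact h.1
    · exact h.2 b hb

/-! ### Iteration over lists -/

/-- Iteration over a list from the left, with an a priori bound for the weight of the
accumulators that occur. -/
theorem foldl_of_bound {f : γ → List α} {g : γ → β} {h : γ → α → β → β} (hf : Cmp C f)
    (hg : Cmp C g) (hh : Cmp C fun x : γ × α × β => h x.1 x.2.1 x.2.2) {B : ℕ → ℕ} (hB : C.mem B)
    (hw : ∀ c l, l <+: f c → wt (l.foldl (fun b a => h c a b) (g c)) ≤ B (wt c)) :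
    Cmp C fun c => (f c).foldl (fun b a => h c a b) (g c) := by
  obtain ⟨p, m, S, c, hS, hSw, hSb, hSm⟩ := pair id (pair hf hg)
  obtain ⟨q, n, T, d, hT, hTw, hTb, hTm⟩ := hh
  have hbd : ∀ L x, bd L x → ∀ l, l <+: f x → bd L (l.foldl (fun b a => h x a b) (g x)) := by
    intro L x hx l
    induction l using List.reverseRecOn with
    | nil => exact fun _ => (hSb L x hx).2.2
    | append_singleton l a ih =>
      intro hl
      rw [List.foldl_append]
      refine hTb L (x, a, _) ⟨hx, (hSb L x hx).2.1 a (hl.subset (by simp)), ih ?_⟩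
      exact (List.prefix_append _ _).trans hl
  refine intro (.seq p (Maps.foldlProg (max m n) q)) (max m n + 3) hB
    ((Dominated.pow hS c).add ((((Dominated.of_mem hS).add (.const 1)).mul
      (((Dominated.pow (C.comp hT (C.add (C.const 2) (C.add C.id (C.add hS hB)))) d).add
        ((Dominated.const 20).mul (.size (C.add C.id (C.add hS hB))))).add (.const 20))).add
      ((Dominated.const 60).mul (.size (C.add C.id (C.add hS hB)))) |>.add (.const 60)))
    (fun x => hw x _ List.prefix_rfl) (fun L x hx => hbd L x hx _ List.prefix_rfl) fun L x hx => ?_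
  have hSx := hSw x
  simp only [wt_mk] at hSx
  have hxb : bd L x ∧ bd L (f x) ∧ bd L (g x) := hSb L x hx
  refine ((hSm L x hx).mono (Nat.le_add_right_of_le (le_max_left _ _)) le_rfl).seq ?_
  -- `S (wt x)` bounds the weights of the list and of the initial value, `B (wt x)` that of the
  -- accumulators
  have hs : ∀ {ε : Type} [Enc ε] (e : ε), bd L e → wt e ≤ wt x + (S (wt x) + B (wt x)) →
      (enc e).size ≤ (wt x + (S (wt x) + B (wt x))) * (L + 1) :=
    fun e he hwe => (size_le he).trans (Nat.mul_le_mul_right _ hwe)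
  refine (Maps.foldl (c := enc x) enc enc (fun b a => h x a b)
    (u := T (2 + (wt x + (S (wt x) + B (wt x)))) * (L + 1) ^ d)
    (N := (wt x + (S (wt x) + B (wt x))) * (L + 1)) (f x) (g x) ?_ ?_ ?_ ?_).mono le_rfl ?_
  · exact hs x hx (by omega)
  · exact hs (f x) hxb.2.1 (by omega)
  · exact fun l hl => hs _ (hbd L x hx l hl) (by have := hw x l hl; omega)
  · intro l a hl
    have hl' : l <+: f x := (List.prefix_append _ _).trans hl
    have ha : a ∈ f x := hl.subset (by simp)
    refine (hTm L (x, a, l.foldl (fun b a => h x a b) (g x))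
      ⟨hx, hxb.2.1 a ha, hbd L x hx l hl'⟩).mono (le_max_right _ _) ?_
    refine Nat.mul_le_mul_right _ (C.monotone hT ?_)
    have h₁ := hw x l hl'
    have h₂ := wt_le_of_mem ha
    simp only [wt_mk]
    omega
  · have h₁ : (f x).length + 1 ≤ S (wt x) + 1 := by have := length_lt_wt (f x); omega
    have h₂ := Nat.mul_le_mul_right (T (2 + (wt x + (S (wt x) + B (wt x)))) * (L + 1) ^ d +
      20 * ((wt x + (S (wt x) + B (wt x))) * (L + 1)) + 20) h₁
    omega

theorem reverse {f : α → List β} (hf : Cmp C f) : Cmp C fun a => (f a).reverse := by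
  refine comp (g := List.reverse) ?_ hf
  refine (foldl_of_bound (f := fun l : List β => l) (g := fun _ => []) (h := fun _ a b => a :: b)
    id nil (cons id.snd.fst id.snd.snd) C.id fun c l hl => ?_).of_eq fun l => ?_
  · rw [List.foldl_flip_cons_eq_append', List.append_nil, wt_reverse]
    exact wt_sublist hl.sublist
  · rw [List.foldl_flip_cons_eq_append', List.append_nil]

/-- Iteration over a list, with an a priori bound for the weight of the accumulator. -/
theorem foldr_of_bound {f : γ → List α} {g : γ → β} {h : γ → α → β → β} (hf : Cmp C f)
    (hg : Cmp C g) (hh : Cmp C fun x : γ × α × β => h x.1 x.2.1 x.2.2) {B : ℕ → ℕ} (hB : C.mem B)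
    (hw : ∀ c (l : List α), wt (l.foldr (h c) (g c)) ≤ B (wt c + wt l)) :
    Cmp C fun c => (f c).foldr (h c) (g c) := by
  have hf' := hf
  obtain ⟨-, -, S, -, hS, hSw, -⟩ := hf'
  refine (foldl_of_bound (reverse hf) hg hh (C.comp hB (C.add C.id hS))
    fun c l hl => ?_).of_eq fun c => ?_
  · rw [← List.foldr_reverse]
    refine (hw c _).trans (C.monotone hB (Nat.add_le_add_left ?_ _))
    rw [wt_reverse]
    exact (wt_sublist hl.sublist).trans ((wt_reverse _).le.trans (hSw c))
  · rw [List.foldl_reverse]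

/-- Iteration over a list. Iterating a primitive recursive bound gives a primitive recursive
bound, so nothing has to be known about the accumulator. -/
theorem foldr {f : γ → List α} {g : γ → β} {h : γ → α → β → β} (hf : Cmp .primrec f)
    (hg : Cmp .primrec g) (hh : Cmp .primrec fun x : γ × α × β => h x.1 x.2.1 x.2.2) :
    Cmp .primrec fun c => (f c).foldr (h c) (g c) := by
  have hg' := hg
  have hh' := hh
  obtain ⟨-, -, S, -, hS, hSw, -⟩ := hg'
  obtain ⟨-, -, T, -, hT, hTw, -⟩ := hh'
  -- `B n k` bounds the accumulator after `k` steps, on inputs of weight at most `n`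
  let B : ℕ → ℕ → ℕ := fun n k => Nat.rec (S n) (fun _ v => T (2 + n + v) + v) k
  have hB₀ : ∀ n, B n 0 = S n := fun _ => rfl
  have hB₁ : ∀ n k, B n (k + 1) = T (2 + n + B n k) + B n k := fun _ _ => rfl
  have hBk : ∀ n, Monotone (B n) := fun n => monotone_nat_of_le_succ fun k => by
    rw [hB₁]; omega
  have hBn : ∀ k, Monotone fun n => B n k := by
    intro k n n' hn
    induction k with
    | zero => exact hS.1 hn
    | succ k ih =>
      simp only [hB₁]
      exact add_le_add (hT.1 (by simp only at ih; omega)) ih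
  refine foldr_of_bound hf hg hh (B := fun n => B n n) ⟨fun n n' hn => ?_, ?_⟩ fun c l => ?_
  · exact (hBk n hn).trans (hBn n' hn)
  · refine Primrec.nat_rec' (f := fun n : ℕ => n) (g := S)
      (h := fun n x => T (2 + n + x.2) + x.2) Primrec.id hS.2 ?_
    have h₂ : Primrec fun x : ℕ × ℕ × ℕ => x.2.2 := Primrec.snd.comp Primrec.snd
    exact Primrec.nat_add.comp (hT.2.comp (Primrec.nat_add.comp
      (Primrec.nat_add.comp (Primrec.const 2) Primrec.fst) h₂)) h₂
  · have key : ∀ n, wt c + wt l ≤ n → wt (l.foldr (h c) (g c)) ≤ B n l.length := by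
      intro n hn
      induction l with
      | nil => exact (hSw c).trans (hS.1 (by omega))
      | cons a l ih =>
        rw [wt_cons] at hn
        have h₁ := ih (by omega)
        refine (hTw (c, a, _)).trans ((hT.1 ?_).trans (Nat.le_add_right _ _))
        simp only [wt_mk]
        change _ ≤ 2 + n + B n l.length
        omega
    exact (key _ le_rfl).trans (hBk _ (by have := length_lt_wt l; omega))

end Cmp

/-! ### Functions on lists -/

namespace Cmp

variable {C : BoundClass} {α β γ δ : Type} [Enc α] [Enc β] [Enc γ] [Enc δ]

/-- Iteration over a list, if each step increases the weight of the accumulator by an amount that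
is bounded independently of the accumulator. -/
theorem foldr_of_step_bound {f : γ → List α} {g : γ → β} {h : γ → α → β → β} (hf : Cmp C f)
    (hg : Cmp C g) (hh : Cmp C fun x : γ × α × β => h x.1 x.2.1 x.2.2) {D : ℕ → ℕ} (hD : C.mem D)
    (hw : ∀ c a b, wt (h c a b) ≤ D (wt c + wt a) + wt b) :
    Cmp C fun c => (f c).foldr (h c) (g c) := by
  have hg' := hg
  obtain ⟨-, -, S, -, hS, hSw, -⟩ := hg'
  refine foldr_of_bound hf hg hh (B := fun n => S n + n * D n) (C.add hS (C.mul C.id hD))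
    fun c l => ?_
  have key : ∀ n, wt c + wt l ≤ n → wt (l.foldr (h c) (g c)) ≤ S n + l.length * D n := by
    intro n hn
    induction l with
    | nil => exact (hSw c).trans ((C.monotone hS (by omega)).trans (Nat.le_add_right _ _))
    | cons a l ih =>
      rw [wt_cons] at hn
      have h₁ := ih (by omega)
      have h₂ := hw c a (l.foldr (h c) (g c))
      have h₃ : D (wt c + wt a) ≤ D n := C.monotone hD (by omega)
      simp only [List.foldr_cons, List.length_cons, add_mul]
      omega
  exact (key _ le_rfl).trans (Nat.add_le_add_left
    (Nat.mul_le_mul_right _ (by have := length_lt_wt l; omega)) _)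

theorem append {f g : α → List β} (hf : Cmp C f) (hg : Cmp C g) : Cmp C fun a => f a ++ g a :=
  (foldr_of_step_bound (h := fun _ a b => a :: b) hf hg (cons id.snd.fst id.snd.snd)
    (C.add (C.const 1) C.id) fun c a b => by rw [wt_cons]; omega).of_eq fun a => by simp

theorem map {f : γ → List α} {g : γ → α → β} (hf : Cmp C f)
    (hg : Cmp C fun x : γ × α => g x.1 x.2) : Cmp C fun c => (f c).map (g c) := by
  have hg' := hg
  obtain ⟨-, -, S, -, hS, hSw, -⟩ := hg'
  refine (foldr_of_step_bound (h := fun c a b => g c a :: b) hf nil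
    (cons (hg.comp (id.fst.pair id.snd.fst)) id.snd.snd)
    (C.add (C.const 1) (C.comp hS (C.add (C.const 1) C.id))) fun c a b => ?_).of_eq
    fun c => (List.map_eq_foldr ..).symm
  have : wt (g c a) ≤ _ := hSw (c, a)
  rw [wt_mk, add_assoc] at this
  rw [wt_cons]
  omega

theorem filter {f : γ → List α} {p : γ → α → Bool} (hf : Cmp C f)
    (hp : Cmp C fun x : γ × α => p x.1 x.2) : Cmp C fun c => (f c).filter (p c) := by
  refine (foldr_of_step_bound (h := fun c a b => bif p c a then a :: b else b) hf nil
    (cond (hp.comp (id.fst.pair id.snd.fst)) (cons id.snd.fst id.snd.snd) id.snd.snd)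
    (C.add (C.const 1) C.id) fun c a b => ?_).of_eq fun c => ?_
  · cases p c a
    · simp
    · simp only [cond_true, wt_cons]; omega
  · generalize f c = l
    induction l with
    | nil => rfl
    | cons a l ih =>
      simp only [List.foldr_cons, ih]
      cases h : p c a <;> simp [h]

theorem flatMap {f : γ → List α} {g : γ → α → List β} (hf : Cmp C f)
    (hg : Cmp C fun x : γ × α => g x.1 x.2) : Cmp C fun c => (f c).flatMap (g c) := by
  have hg' := hg
  obtain ⟨-, -, S, -, hS, hSw, -⟩ := hg'
  refine (foldr_of_step_bound (h := fun c a b => g c a ++ b) hf nil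
    (append (hg.comp (id.fst.pair id.snd.fst)) id.snd.snd)
    (C.comp hS (C.add (C.const 1) C.id)) fun c a b => ?_).of_eq fun c => ?_
  · have h₁ : wt (g c a) ≤ _ := hSw (c, a)
    have h₂ := wt_append (g c a) b
    rw [wt_mk, add_assoc] at h₁
    omega
  · generalize f c = l
    induction l with
    | nil => rfl
    | cons a l ih => simp [ih]

theorem any {f : γ → List α} {p : γ → α → Bool} (hf : Cmp C f)
    (hp : Cmp C fun x : γ × α => p x.1 x.2) : Cmp C fun c => (f c).any (p c) := by
  refine (foldr_of_step_bound (h := fun c a b => p c a || b) hf false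
    (or (hp.comp (id.fst.pair id.snd.fst)) id.snd.snd) (C.const 3)
    fun c a b => (wt_bool_le _).trans (by omega)).of_eq fun c => ?_
  generalize f c = l
  induction l with
  | nil => rfl
  | cons a l ih => simp [ih]

theorem all {f : γ → List α} {p : γ → α → Bool} (hf : Cmp C f)
    (hp : Cmp C fun x : γ × α => p x.1 x.2) : Cmp C fun c => (f c).all (p c) :=
  (not (any (p := fun c a => !p c a) hf (not hp))).of_eq fun c => by
    rw [← List.not_all_eq_any_not, Bool.not_not]

theorem mem [DecidableEq β] {f : α → β} {g : α → List β} (hf : Cmp C f) (hg : Cmp C g) :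
    Cmp C fun a => decide (f a ∈ g a) :=
  (any (p := fun a b => decide (f a = b)) hg (beq (hf.comp id.fst) id.snd)).of_eq fun a => by
    rw [Bool.eq_iff_iff]
    simp

theorem subset [DecidableEq β] {f g : α → List β} (hf : Cmp C f) (hg : Cmp C g) :
    Cmp C fun a => decide (f a ⊆ g a) :=
  (all (p := fun a b => decide (b ∈ g a)) hf (mem id.snd (hg.comp id.fst))).of_eq fun a => by
    rw [Bool.eq_iff_iff]
    simp [List.subset_def]

theorem dedup [DecidableEq β] {f : α → List β} (hf : Cmp C f) :
    Cmp C fun a => (f a).dedup := by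
  refine (foldr_of_step_bound (h := fun _ a b => if a ∈ b then b else a :: b) hf nil
    (ite (mem id.snd.fst id.snd.snd) id.snd.snd (cons id.snd.fst id.snd.snd))
    (C.add (C.const 1) C.id) fun c a b => ?_).of_eq fun c => ?_
  · split_ifs
    · omega
    · rw [wt_cons]; omega
  · generalize f c = l
    induction l with
    | nil => rfl
    | cons a l ih =>
      simp only [List.foldr_cons, ih]
      split_ifs with h
      · exact (List.dedup_cons_of_mem' h).symm
      · exact (List.dedup_cons_of_notMem' h).symm

end Cmp

/-! ### Functions on terms and atoms -/

/-- The name of a variable or constant. -/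
def Term.name : Term → ℕ
  | .var X => X
  | .const c => c

/-- Whether a term is a constant. -/
def Term.isConst : Term → Bool
  | .var _ => false
  | .const _ => true

/-- A term is a name with a tag; the tag contributes at most three nodes to its encoding. The
weight `3` is also a lower bound for the size of the encoding. -/
instance : Enc Term where
  enc := Term.encode
  wt _ := 3
  bd L t := bd L t.name
  enc_injective := by
    rintro (X | c) (Y | d) h <;> simp_all [Term.encode, Data.ofBool, ofNat_injective.eq_iff]
  size_le := by
    rintro L (X | c) h <;>
    · have h' : (Data.ofNat _).size ≤ L := h
      have h₁ := h'.trans' (Data.one_le_size _)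
      simp only [Term.encode, Data.ofBool, Data.size, Term.name] at h' ⊢
      omega
  wt_le := by
    rintro (n | n) <;>
    · have := (Data.ofNat n).one_le_size
      simp only [Term.encode, Data.ofBool, Data.size]
      omega
  bd_mono h h' := bd_mono h h'
  bd_size := by
    rintro (X | c) <;>
    · simp only [Term.encode, Data.size, Term.name, bd]
      omega

/-- An atom is measured as the pair of its relation symbol and its arguments. -/
instance : Enc (Atom ℕ) where
  enc := Atom.encode
  wt a := wt (a.rel, a.args)
  bd L a := bd L (a.rel, a.args)
  enc_injective := by
    rintro ⟨r, u⟩ ⟨r', u'⟩ h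
    have := enc_injective (a₁ := (r, u)) (a₂ := (r', u')) h
    simpa using this
  size_le h := size_le (a := (_, _)) h
  wt_le a := wt_le (a.rel, a.args)
  bd_mono h h' := bd_mono h h'
  bd_size a := bd_size (a.rel, a.args)

theorem wt_atom (a : Atom ℕ) : wt a = 3 + 4 * a.args.length := by
  change wt (a.rel, a.args) = _
  rw [wt_mk, wt_list]
  change 1 + 1 + (1 + (a.args.map fun _ => 1 + 3).sum) = _
  simp
  omega

namespace Cmp

variable {C : BoundClass} {α β γ δ : Type} [Enc α] [Enc β] [Enc γ] [Enc δ]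

theorem termName {f : α → Term} (hf : Cmp C f) : Cmp C fun a => (f a).name :=
  comp (g := Term.name) (of_tl (by rintro (X | c) <;> rfl) (fun _ => by change 1 ≤ 3; omega)
    fun _ _ h => h) hf

theorem isConst {f : α → Term} (hf : Cmp C f) : Cmp C fun a => (f a).isConst :=
  comp (g := Term.isConst) (of_hd (by rintro (X | c) <;> rfl) (fun _ => wt_bool_le _)
    fun _ _ _ => trivial) hf

theorem args {f : α → Atom ℕ} (hf : Cmp C f) : Cmp C fun a => (f a).args :=
  comp (g := Atom.args) (of_tl (fun _ => rfl)
    (fun a => by change _ ≤ wt (a.rel, a.args); rw [wt_mk]; omega)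
    fun L a (h : bd L a.rel ∧ bd L a.args) => h.2) hf

theorem varList {f : α → Atom ℕ} (hf : Cmp C f) : Cmp C fun a => (f a).varList := by
  refine (map (g := fun _ => Term.name) (filter (p := fun _ t => !t.isConst) (args hf)
    (not (isConst id.snd))) (termName id.snd)).of_eq fun a => ?_
  unfold Atom.varList
  generalize (f a).args = l
  induction l with
  | nil => rfl
  | cons t l ih => cases t <;> simp_all [Term.isConst, Term.var?, Term.name, List.filterMap_cons]

theorem atomMap {f : γ → Atom ℕ} {h : γ → Term → Term} (hf : Cmp C f)
    (hh : Cmp C fun x : γ × Term => h x.1 x.2) : Cmp C fun c => (f c).map (h c) := by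
  have hrel : Cmp C fun c => (f c).rel :=
    comp (g := Atom.rel) (of_hd (fun _ => rfl)
      (fun a => by change _ ≤ wt (a.rel, a.args); rw [wt_mk]; omega)
      fun L a (h : bd L a.rel ∧ bd L a.args) => h.1) hf
  refine comp (g := fun x : ℕ × List Term => (⟨x.1, x.2⟩ : Atom ℕ)) ?_
    (pair hrel (map (args hf) hh))
  exact of_enc_eq (k := 0) (fun _ => rfl) (fun _ => le_rfl) fun _ _ h => h

end Cmp

/-! ### Acyclicity and running intersections -/

/-- The running intersection property, for a list of sets that grows at its head: each set has a
predecessor that contains all the elements it shares with the sets before it. -/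
def RunningIntersection {α : Type} : List (Set α) → Prop
  | [] => True
  | e :: es => RunningIntersection es ∧
      (es = [] ∨ ∃ f ∈ es, ∀ x ∈ e, (∃ g ∈ es, x ∈ g) → x ∈ f)

/-- There is a path from `a` to `b` all of whose vertices belong to `S`, or `a = b`. -/
def LinkedIn {V : Type} (G : SimpleGraph V) (S : Set V) : V → V → Prop :=
  Relation.ReflTransGen fun x y => x ∈ S ∧ y ∈ S ∧ G.Adj x y

section graphs

variable {V : Type} {G : SimpleGraph V} {S : Set V}

theorem LinkedIn.symm {a b : V} (h : LinkedIn G S a b) : LinkedIn G S b a := by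
  induction h with
  | refl => exact .refl
  | tail _ h ih => exact .head ⟨h.2.1, h.1, h.2.2.symm⟩ ih

theorem preconnected_induce_iff :
    (G.induce S).Preconnected ↔ ∀ a ∈ S, ∀ b ∈ S, LinkedIn G S a b := by
  constructor
  · intro h a ha b hb
    have := (SimpleGraph.reachable_iff_reflTransGen _ _).1 (h ⟨a, ha⟩ ⟨b, hb⟩)
    exact this.lift Subtype.val fun x y hxy => ⟨x.2, y.2, hxy⟩
  · rintro h ⟨a, ha⟩ ⟨b, hb⟩
    have := h a ha b hb
    induction this with
    | refl => exact SimpleGraph.Reachable.refl _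
    | tail _ hxy ih =>
      refine (ih hxy.1).trans (SimpleGraph.Adj.reachable ?_)
      exact hxy.2.2

/-- Removing a vertex with a single neighbour does not disconnect the remaining vertices. -/
theorem LinkedIn.of_leaf [DecidableEq V] {S' : Set V} {v f a b : V} (h : LinkedIn G S a b)
    (hS : ∀ x ∈ S, x ≠ v → x ∈ S') (hv : ∀ u ∈ S, G.Adj v u → u = f) (ha : a ≠ v) (hb : b ≠ v) :
    LinkedIn G S' a b := by
  have key : LinkedIn G S' (if a = v then f else a) (if b = v then f else b) := by
    clear ha hb
    induction h with
    | refl => exact .refl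
    | @tail x y _ hxy ih =>
      obtain ⟨hx, hy, hadj⟩ := hxy
      by_cases hxv : x = v
      · subst hxv
        rw [if_pos rfl] at ih
        rw [if_neg hadj.ne', hv y hy hadj]
        exact ih
      · rw [if_neg hxv] at ih
        by_cases hyv : y = v
        · subst hyv
          rw [if_pos rfl]
          rwa [hv x hx hadj.symm] at ih
        · rw [if_neg hyv]
          exact ih.tail ⟨hS x hx hxv, hS y hy hyv, hadj⟩
  rwa [if_neg ha, if_neg hb] at key

end graphs

section acyclic

variable {α : Type}

/-- A list with the running intersection property yields a join tree: each set in turn is attached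
as a leaf to a predecessor. The sets `P` of sets to be connected are those of the form
`{e | x ∈ e}`, and the set of all sets. -/
theorem RunningIntersection.exists_graph {l : List (Set α)} (hl : RunningIntersection l) :
    ∃ G : SimpleGraph (Set α), G.IsAcyclic ∧ (∀ a b, G.Adj a b → a ∈ l) ∧
      ∀ P : Set (Set α), (P = Set.univ ∨ ∃ x, P = {e | x ∈ e}) → ∀ a ∈ l, a ∈ P → ∀ b ∈ l, b ∈ P →
        LinkedIn G {e | e ∈ l ∧ e ∈ P} a b := by
  induction l with
  | nil => exact ⟨⊥, SimpleGraph.isAcyclic_bot, by simp, by simp⟩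
  | cons e es ih =>
    obtain ⟨G, hG, hadj, hP⟩ := ih hl.1
    by_cases he : e ∈ es
    · refine ⟨G, hG, fun a b h => List.mem_cons_of_mem _ (hadj a b h), ?_⟩
      have : ∀ a, a ∈ e :: es ↔ a ∈ es := fun a => by
        rw [List.mem_cons]
        exact ⟨fun h => h.elim (fun h => h ▸ he) id, Or.inr⟩
      simpa only [this] using hP
    rcases hl.2 with rfl | ⟨f, hf, hfe⟩
    · refine ⟨⊥, SimpleGraph.isAcyclic_bot, by simp, fun P _ a ha _ b hb _ => ?_⟩
      rw [List.mem_singleton.1 ha, List.mem_singleton.1 hb]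
      exact .refl
    have hef : e ≠ f := fun h => he (h ▸ hf)
    have hmono : ∀ {P : Set (Set α)} {a b}, LinkedIn G {e | e ∈ es ∧ e ∈ P} a b →
        LinkedIn (G ⊔ SimpleGraph.edge e f) {e' | e' ∈ e :: es ∧ e' ∈ P} a b := by
      intro P a b h
      refine Relation.ReflTransGen.mono (fun x y hxy => ?_) _ _ h
      exact ⟨⟨List.mem_cons_of_mem _ hxy.1.1, hxy.1.2⟩,
        ⟨List.mem_cons_of_mem _ hxy.2.1.1, hxy.2.1.2⟩, Or.inl hxy.2.2⟩
    refine ⟨G ⊔ SimpleGraph.edge e f, ?_, ?_, ?_⟩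
    · refine SimpleGraph.IsAcyclic.sup_edge_of_not_reachable ?_ hG
      rintro ⟨w⟩
      cases w with
      | nil => exact hef rfl
      | cons h _ => exact he (hadj _ _ h)
    · rintro a b (h | h)
      · exact List.mem_cons_of_mem _ (hadj a b h)
      · rw [SimpleGraph.edge_adj] at h
        rcases h.1 with ⟨rfl, rfl⟩ | ⟨rfl, rfl⟩
        · exact List.mem_cons_self
        · exact List.mem_cons_of_mem _ hf
    · intro P hPP
      -- the leaf `e` is linked to all members of `P` through its neighbour `f`
      have hleaf : e ∈ P → ∀ b ∈ es, b ∈ P →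
          LinkedIn (G ⊔ SimpleGraph.edge e f) {e' | e' ∈ e :: es ∧ e' ∈ P} e b := by
        intro heP b hb hbP
        have hfP : f ∈ P := by
          rcases hPP with rfl | ⟨x, rfl⟩
          · trivial
          · exact hfe x heP ⟨b, hb, hbP⟩
        refine Relation.ReflTransGen.head ⟨⟨List.mem_cons_self, heP⟩,
          ⟨List.mem_cons_of_mem _ hf, hfP⟩, Or.inr ?_⟩ (hmono (hP P hPP f hf hfP b hb hbP))
        rw [SimpleGraph.edge_adj]
        exact ⟨Or.inl ⟨rfl, rfl⟩, hef⟩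
      intro a ha haP b hb hbP
      rcases List.mem_cons.1 ha with rfl | ha' <;> rcases List.mem_cons.1 hb with rfl | hb'
      · exact .refl
      · exact hleaf haP b hb' hbP
      · exact (hleaf hbP a ha' haP).symm
      · exact hmono (hP P hPP a ha' haP b hb' hbP)

theorem RunningIntersection.isAcyclic {l : List (Set α)} (hl : RunningIntersection l)
    {H : Hypergraph α} (hH : ∀ e, e ∈ H.edgeSet ↔ e ∈ l) : IsAcyclic H := by
  obtain ⟨G, hG, -, hP⟩ := hl.exists_graph
  have key : ∀ {P : Set (Set α)} {a b : Set α} (_ : LinkedIn G {e | e ∈ l ∧ e ∈ P} a b)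
      (ha : a ∈ H.edgeSet) (hb : b ∈ H.edgeSet),
      LinkedIn (G.induce H.edgeSet) {e | e.1 ∈ P} ⟨a, ha⟩ ⟨b, hb⟩ := by
    intro P a b h ha hb
    induction h with
    | refl => exact .refl
    | tail _ hxy ih =>
      exact (ih ((hH _).2 hxy.1.1)).tail ⟨hxy.1.2, hxy.2.1.2, hxy.2.2⟩
  refine ⟨G.induce H.edgeSet, hG.induce _, ?_, fun X _ => ?_⟩
  · refine preconnected_induce_iff.2 fun a ha b hb => ?_
    have := hP Set.univ (Or.inl rfl) a ((hH a).1 ha) trivial b ((hH b).1 hb) trivial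
    exact Relation.ReflTransGen.mono (fun x y h =>
      ⟨(hH x).2 h.1.1, (hH y).2 h.2.1.1, h.2.2⟩) _ _ this
  · refine preconnected_induce_iff.2 fun a ha b hb => ?_
    exact key (hP {e | X ∈ e} (Or.inr ⟨X, rfl⟩) a ((hH a).1 a.2) ha b ((hH b).1 b.2) hb) a.2 b.2

/-- The bags of a join tree, listed so that each vertex is a leaf of the subtree on the vertices
up to it, have the running intersection property. -/
theorem exists_runningIntersection {V : Type} {G : SimpleGraph V} (hG : G.IsAcyclic)
    (bag : V → Set α) (S : Finset V)
    (hP : ∀ P : Set V, (P = Set.univ ∨ ∃ x, P = {v | x ∈ bag v}) → ∀ a ∈ S, a ∈ P →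
      ∀ b ∈ S, b ∈ P → LinkedIn G {v | v ∈ S ∧ v ∈ P} a b) :
    ∃ l, RunningIntersection l ∧ ∀ e, e ∈ l ↔ ∃ v ∈ S, bag v = e := by
  classical
  induction hn : S.card generalizing S with
  | zero =>
    rw [Finset.card_eq_zero] at hn
    exact ⟨[], trivial, by simp [hn]⟩
  | succ n ih =>
    by_cases h1 : n = 0
    · subst h1
      obtain ⟨v, rfl⟩ := Finset.card_eq_one.1 hn
      exact ⟨[bag v], ⟨trivial, Or.inl rfl⟩, by simp [eq_comm]⟩
    obtain ⟨v, f, hv, hf, hvf, huniq⟩ : ∃ v f, v ∈ S ∧ f ∈ S ∧ G.Adj v f ∧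
        ∀ u ∈ S, G.Adj v u → u = f := by
      have hpre : (G.induce (S : Set V)).Preconnected := preconnected_induce_iff.2
        fun a ha b hb => Relation.ReflTransGen.mono (fun x y h => ⟨h.1.1, h.2.1.1, h.2.2⟩)
          _ _ (hP Set.univ (Or.inl rfl) a ha trivial b hb trivial)
      have hnt : Nontrivial (S : Set V) := by
        rw [Set.nontrivial_coe_sort]
        exact Finset.one_lt_card_iff_nontrivial.1 (by omega)
      have hT : (G.induce (S : Set V)).IsTree := ⟨⟨hpre⟩, hG.induce _⟩
      obtain ⟨⟨v, hv⟩, hdeg⟩ := hT.exists_vert_degree_one_of_nontrivial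
      obtain ⟨⟨f, hf⟩, hvf, huniq⟩ := SimpleGraph.degree_eq_one_iff_existsUnique_adj.1 hdeg
      exact ⟨v, f, hv, hf, hvf, fun u hu h => congrArg Subtype.val (huniq ⟨u, hu⟩ h)⟩
    obtain ⟨l, hl, hmem⟩ := ih (S.erase v) (fun P hPP a ha haP b hb hbP => by
      rw [Finset.mem_erase] at ha hb
      exact (hP P hPP a ha.2 haP b hb.2 hbP).of_leaf
        (fun x hx hxv => ⟨Finset.mem_erase.2 ⟨hxv, hx.1⟩, hx.2⟩)
        (fun u hu => huniq u hu.1) ha.1 hb.1) (by rw [Finset.card_erase_of_mem hv]; omega)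
    refine ⟨bag v :: l, ⟨hl, Or.inr ⟨bag f, (hmem _).2
      ⟨f, Finset.mem_erase.2 ⟨hvf.ne', hf⟩, rfl⟩, ?_⟩⟩, fun e => ?_⟩
    · rintro x hx ⟨g, hg, hxg⟩
      obtain ⟨w, hw, rfl⟩ := (hmem g).1 hg
      rw [Finset.mem_erase] at hw
      -- the first step of a path from `v` to `w` within `{u | x ∈ bag u}` leads to `f`
      rcases (hP {u | x ∈ bag u} (Or.inr ⟨x, rfl⟩) v hv hx w hw.2 hxg).cases_head with h | ⟨u, h, -⟩
      · exact absurd h.symm hw.1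
      · exact huniq u h.2.1.1 h.2.2 ▸ h.2.1.2
    · rw [List.mem_cons, hmem]
      constructor
      · rintro (rfl | ⟨w, hw, rfl⟩)
        · exact ⟨v, hv, rfl⟩
        · exact ⟨w, Finset.mem_of_mem_erase hw, rfl⟩
      · rintro ⟨w, hw, rfl⟩
        by_cases hwv : w = v
        · exact Or.inl (hwv ▸ rfl)
        · exact Or.inr ⟨w, Finset.mem_erase.2 ⟨hwv, hw⟩, rfl⟩

theorem IsAcyclic.exists_runningIntersection {H : Hypergraph α} (hH : IsAcyclic H)
    (hfin : H.vertexSet.Finite) :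
    ∃ l, RunningIntersection l ∧ ∀ e, e ∈ l ↔ e ∈ H.edgeSet := by
  obtain ⟨T, hT, hpre, hX⟩ := hH
  have hE : H.edgeSet.Finite :=
    hfin.finite_subsets.subset fun e he => H.subset_vertexSet_of_mem_edgeSet' he
  have := hE.fintype
  obtain ⟨l, hl, hmem⟩ := SharpDec.exists_runningIntersection hT Subtype.val Finset.univ (by
    rintro P (rfl | ⟨x, rfl⟩) a - ha b - hb
    · have := (SimpleGraph.reachable_iff_reflTransGen _ _).1 (hpre a b)
      exact Relation.ReflTransGen.mono (fun x y h => by simpa using h) _ _ this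
    · have := preconnected_induce_iff.1
        (hX x (H.subset_vertexSet_of_mem_edgeSet' a.2 ha)) a ha b hb
      exact Relation.ReflTransGen.mono (fun x y h => by simpa using h) _ _ this)
  exact ⟨l, hl, fun e => by simp [hmem]⟩

/-- Restricting the sets to `U` keeps the running intersection property. -/
theorem RunningIntersection.map_inter {l : List (Set α)} (hl : RunningIntersection l)
    (U : Set α) : RunningIntersection (l.map fun e => {x | x ∈ U ∧ x ∈ e}) := by
  induction l with
  | nil => trivial
  | cons e es ih =>
    refine ⟨ih hl.1, hl.2.imp (fun h => by simp [h]) ?_⟩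
    rintro ⟨f, hf, h⟩
    refine ⟨_, List.mem_map_of_mem hf, fun x hx => ?_⟩
    rintro ⟨g, hg, hxg⟩
    obtain ⟨g, hg', rfl⟩ := List.mem_map.1 hg
    exact ⟨hx.1, h x hx.2 ⟨g, hg', hxg.2⟩⟩

theorem RunningIntersection.map_dedup {β : Type} [DecidableEq β] {l : List β} {s : β → Set α}
    (hl : RunningIntersection (l.map s)) : RunningIntersection (l.dedup.map s) := by
  induction l with
  | nil => trivial
  | cons e es ih =>
    have ih := ih hl.1
    by_cases he : e ∈ es
    · rwa [List.dedup_cons_of_mem he]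
    · rw [List.dedup_cons_of_notMem he]
      refine ⟨ih, hl.2.imp (fun h => ?_) ?_⟩
      · rw [List.map_eq_nil_iff] at h
        simp [h]
      · simp

end acyclic

/-! ### Cores and frontiers -/

theorem Covers.trans {α : Type} {H₁ H₂ H₃ : Hypergraph α} (h : Covers H₁ H₂) (h' : Covers H₂ H₃) :
    Covers H₁ H₃ := by
  intro e he
  obtain ⟨e', he', hee⟩ := h e he
  obtain ⟨e'', he'', hee'⟩ := h' e' he'
  exact ⟨e'', he'', hee.trans hee'⟩

theorem mem_vertexSet_hypergraphOf {R : Type} {A : Set (Atom R)} {X : ℕ} :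
    X ∈ (hypergraphOf A).vertexSet ↔ ∃ e ∈ (hypergraphOf A).edgeSet, X ∈ e := by
  simp [hypergraphOf]

theorem frontier_mono {α : Type} {H H' : Hypergraph α} (hv : H.vertexSet ⊆ H'.vertexSet)
    (he : H.edgeSet ⊆ H'.edgeSet) (Y : α) (W : Set α) : frontier Y W H ⊆ frontier Y W H' := by
  have hc : component H W Y ⊆ component H' W Y := fun Z hZ => ⟨⟨hv hZ.1.1, hZ.1.2⟩,
    Relation.ReflTransGen.mono (fun a b ⟨e, h, h'⟩ => ⟨e, he h, h'⟩) _ _ hZ.2⟩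
  unfold frontier
  split_ifs
  · exact subset_rfl
  · rintro x ⟨hx, e, ⟨hmem, hne⟩, hxe⟩
    exact ⟨hx, e, ⟨he hmem, hne.mono (Set.inter_subset_inter_right _ hc)⟩, hxe⟩

theorem covers_of_subset {R : Type} {A B : Set (Atom R)} (h : A ⊆ B) :
    Covers (hypergraphOf A) (hypergraphOf B) :=
  fun e he => ⟨e, Set.image_mono h he, subset_rfl⟩

theorem covers_frontierHypergraph_of_subset {R : Type} {A B : Set (Atom R)} (h : A ⊆ B)
    (W : Set ℕ) : Covers (frontierHypergraph (hypergraphOf A) W)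
      (frontierHypergraph (hypergraphOf B) W) := by
  have hv : (hypergraphOf A).vertexSet ⊆ (hypergraphOf B).vertexSet :=
    Set.biUnion_subset_biUnion_left h
  rintro e (⟨Y, hY, rfl⟩ | ⟨he, heW⟩)
  · exact ⟨_, Or.inl ⟨Y, hv hY, rfl⟩, frontier_mono hv (Set.image_mono h) Y W⟩
  · exact ⟨e, Or.inr ⟨Set.image_mono h he, heW⟩, subset_rfl⟩

/-- Instead of the cores one may use the images of all endomorphisms: a core is the image of
an endomorphism, and each such image contains a core, whose hypergraph and frontiers are covered
by those of the image. -/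
theorem exists_core_iff_exists_hom {R : Type} {C : Set (Atom R)} (hC : C.Finite) (W : Set ℕ)
    (Ha H₂ : Hypergraph ℕ) :
    (∃ Q', IsCore Q' C ∧ IsTreeProjection Ha (hypergraphOf Q') H₂ ∧
      Covers (frontierHypergraph (hypergraphOf Q') W) Ha) ↔
    ∃ h, IsHom h C C ∧ IsTreeProjection Ha (hypergraphOf (Atom.map h '' C)) H₂ ∧
      Covers (frontierHypergraph (hypergraphOf (Atom.map h '' C)) W) Ha := by
  constructor
  · rintro ⟨Q', ⟨⟨hQC, h, hh⟩, hmin⟩, hTP, hFr⟩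
    have hsub : Atom.map h '' C ⊆ Q' := Set.image_subset_iff.2 hh.2
    have heq : Q' = Atom.map h '' C := (hmin ⟨hsub.trans hQC, h, hh.1,
      fun a ha => Set.mem_image_of_mem _ ha⟩ hsub).antisymm hsub
    subst heq
    exact ⟨h, ⟨hh.1, fun a ha => hQC (hh.2 a ha)⟩, hTP, hFr⟩
  · rintro ⟨h, hh, ⟨hfin, hacyc, hcov, hcov'⟩, hFr⟩
    have hF : {B | B ⊆ C ∧ ∃ h, IsHom h C B}.Finite := hC.finite_subsets.subset fun B hB => hB.1
    obtain ⟨Q', hQ', hmin⟩ := hF.exists_le_minimal (a := Atom.map h '' C)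
      ⟨Set.image_subset_iff.2 hh.2, h, hh.1, fun a ha => Set.mem_image_of_mem _ ha⟩
    exact ⟨Q', hmin, ⟨hfin, hacyc, (covers_of_subset hQ').trans hcov, hcov'⟩,
      (covers_frontierHypergraph_of_subset hQ' W).trans hFr⟩

/-- A frontier is contained in `s` iff this is witnessed by a set `D` that contains the component,
namely one that is closed under adjacency. -/
theorem frontier_subset_iff {α : Type} {H : Hypergraph α} {W : Set α} {Y : α}
    (hY : Y ∈ H.vertexSet) (hYW : Y ∉ W) (s : Set α) :
    frontier Y W H ⊆ s ↔ ∃ D ⊆ H.vertexSet, Y ∈ D ∧ ∀ e ∈ H.edgeSet,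
      (∃ x ∈ e, x ∈ D ∧ x ∉ W) → ∀ x ∈ e, (x ∈ W ∧ x ∈ s) ∨ (x ∉ W ∧ x ∈ D) := by
  unfold frontier
  rw [if_neg hYW]
  constructor
  · intro h
    refine ⟨component H W Y, fun Z hZ => hZ.1.1, ⟨⟨hY, hYW⟩, .refl⟩, ?_⟩
    rintro e he ⟨x, hxe, hx, hxW⟩ z hz
    by_cases hzW : z ∈ W
    · exact Or.inl ⟨hzW, h ⟨hzW, e, ⟨he, x, hxe, hx⟩, hz⟩⟩
    · exact Or.inr ⟨hzW, ⟨H.subset_vertexSet_of_mem_edgeSet' he hz, hzW⟩,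
        hx.2.tail ⟨e, he, ⟨hxe, hxW⟩, hz, hzW⟩⟩
  · rintro ⟨D, -, hYD, hD⟩
    have hcD : ∀ Z, Relation.ReflTransGen (AdjAvoiding H W) Y Z → Z ∈ D := by
      intro Z hZ
      induction hZ with
      | refl => exact hYD
      | tail _ hab ih =>
        obtain ⟨e, he, ha, hb⟩ := hab
        rcases hD e he ⟨_, ha.1, ih, ha.2⟩ _ hb.1 with h | h
        · exact absurd h.1 hb.2
        · exact h.2
    rintro x ⟨hxW, e, ⟨he, z, hze, hz⟩, hxe⟩
    rcases hD e he ⟨z, hze, hcD z hz.2, hz.1.2⟩ x hxe with h | h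
    · exact h.2
    · exact absurd hxW h.1

/-! ### The search -/

/-- Lists of elements of `S`, among them all those of length at most `S.length`. -/
def listsOver {α : Type} (S : List α) : List (List α) :=
  S.foldr (fun _ acc => acc ++ acc.flatMap fun l => S.map fun a => a :: l) [[]]

theorem mem_listsOver {α : Type} {S l : List α} (hlen : l.length ≤ S.length) (hl : l ⊆ S) :
    l ∈ listsOver S := by
  have key : ∀ (n : List α) (l : List α), l.length ≤ n.length → l ⊆ S →
      l ∈ n.foldr (fun _ acc => acc ++ acc.flatMap fun l => S.map fun a => a :: l) [[]] := by
    intro n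
    induction n with
    | nil =>
      intro l hlen _
      simpa using hlen
    | cons _ n ih =>
      rintro (_ | ⟨a, l⟩) hlen hl
      · exact List.mem_append_left _ (ih [] (Nat.zero_le _) (List.nil_subset _))
      · refine List.mem_append_right _ (List.mem_flatMap.2 ⟨l, ih l ?_ ?_, ?_⟩)
        · simpa using hlen
        · exact fun b hb => hl (List.mem_cons_of_mem _ hb)
        · exact List.mem_map.2 ⟨a, hl List.mem_cons_self, rfl⟩
  exact key S l hlen hl

/-- All pairs of elements of a list. -/
def pairsOf {α : Type} (l : List α) : List (α × α) := l.flatMap fun a => l.map fun b => (a, b)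

/-- The map on terms that is given by a list of pairs, except that it fixes the constants and
the variables in `W`. -/
def subst (W : List ℕ) (σ : List (Term × Term)) (t : Term) : Term :=
  if t.isConst || decide (t.name ∈ W) then t
  else σ.foldr (fun p u => if p.1 = t then p.2 else u) t

/-- The hyperedges of the image under `h` of the coloring of a query with atoms `A` and free
variables `W`. -/
def imageEdges (h : Term → Term) (A : List (Atom ℕ)) (W : List ℕ) : List (List ℕ) :=
  A.map (fun a => (a.map h).varList) ++ W.map fun X => [X]

/-- Test for the condition on `e` in `RunningIntersection (e :: es)`. -/
def hasParent (es : List (List ℕ)) (e : List ℕ) : Bool :=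
  decide (es = []) || es.any fun f => e.all fun x => !(es.any fun g => decide (x ∈ g)) ||
    decide (x ∈ f)

/-- Test for the running intersection property. -/
def hasRunningIntersection (l : List (List ℕ)) : Bool :=
  (l.foldr (fun e (x : Bool × List (List ℕ)) => (x.1 && hasParent x.2 e, e :: x.2)) (true, [])).1

/-- Test whether each member of `E` is contained in a member of `F`. -/
def edgesCovered (E F : List (List ℕ)) : Bool := E.all fun e => F.any fun s => decide (e ⊆ s)

/-- Test for the condition on the edge `e` in `frontier_subset_iff`. -/
def respects (W s D e : List ℕ) : Bool :=
  !(e.any fun x => decide (x ∈ D) && !decide (x ∈ W)) ||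
    e.all fun x => (decide (x ∈ W) && decide (x ∈ s)) || (!decide (x ∈ W) && decide (x ∈ D))

/-- Test whether the frontiers in the hypergraph with edges `E` are contained in members of `l`.
The witnesses `D` in `frontier_subset_iff` are searched in the list `S`. -/
def frontiersCovered (W : List ℕ) (S E l : List (List ℕ)) : Bool :=
  E.all fun e => e.all fun Y => decide (Y ∈ W) || l.any fun s => S.any fun D =>
    decide (Y ∈ D) && E.all fun e => respects W s D e

/-- What the search needs to know about an instance: the atoms of the query, its free variables,
and the sets of variables of the query that occur together in a view. -/
abbrev Kernel := List (Atom ℕ) × List ℕ × List (List ℕ)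

/-- The variables of the query. -/
def Kernel.vars (k : Kernel) : List ℕ := k.1.flatMap Atom.varList

/-- Test whether `σ` describes an endomorphism of the coloring and `l` lists the hyperedges of
a hypergraph as required in a #-decomposition, for the image of that endomorphism. -/
def Kernel.check (k : Kernel) (σ : List (Term × Term)) (l : List (List ℕ)) : Bool :=
  k.1.all (fun a => decide (a.map (subst k.2.1 σ) ∈ k.1)) &&
  hasRunningIntersection l &&
  edgesCovered l k.2.2 &&
  edgesCovered (imageEdges (subst k.2.1 σ) k.1 k.2.1) l &&
  frontiersCovered k.2.1 (listsOver k.vars) (imageEdges (subst k.2.1 σ) k.1 k.2.1) l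

/-- Exhaustive search for a #-decomposition. Its nodes and its hyperedges are returned in a
single list, and the empty list if there is none. -/
def Kernel.solve (k : Kernel) : List (List ℕ) :=
  (listsOver (pairsOf (k.1.flatMap Atom.args))).foldr (fun σ acc =>
    (listsOver (listsOver k.vars)).foldr (fun l acc =>
      bif k.check σ l then l.flatten :: l else acc) acc) []

namespace Cmp

variable {α γ : Type} [Enc α] [Enc γ]

theorem listsOver {f : γ → List α} (hf : Cmp .primrec f) :
    Cmp .primrec fun c => SharpDec.listsOver (f c) :=
  foldr (h := fun c (_ : α) (acc : List (List α)) =>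
      acc ++ acc.flatMap fun l => (f c).map fun a => a :: l) hf
    (const [[]] (by simp [bd]))
    (append id.snd.snd (flatMap (g := fun x l => (f x.1).map fun a => a :: l) id.snd.snd
      (map (g := fun x a => a :: x.2) (hf.comp id.fst.fst) (cons id.snd id.fst.snd))))

theorem pairsOf {f : γ → List α} (hf : Cmp .primrec f) :
    Cmp .primrec fun c => SharpDec.pairsOf (f c) :=
  flatMap (g := fun c a => (f c).map fun b => (a, b)) hf
    (map (g := fun x b => (x.2, b)) (hf.comp id.fst) (pair id.fst.snd id.snd))

theorem subst {W : γ → List ℕ} {σ : γ → List (Term × Term)} {t : γ → Term} (hW : Cmp .primrec W)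
    (hσ : Cmp .primrec σ) (ht : Cmp .primrec t) :
    Cmp .primrec fun c => SharpDec.subst (W c) (σ c) (t c) :=
  ite (p := fun c => ((t c).isConst || decide ((t c).name ∈ W c)) = Bool.true)
    ((or (isConst ht) (mem (termName ht) hW)).of_eq fun c => by simp) ht
    (foldr (h := fun c p u => if p.1 = t c then p.2 else u) hσ ht
      (ite (beq id.snd.fst.fst (ht.comp id.fst)) id.snd.fst.snd id.snd.snd))

theorem imageEdges {h : γ → Term → Term} {A : γ → List (Atom ℕ)} {W : γ → List ℕ}
    (hh : Cmp .primrec fun x : γ × Term => h x.1 x.2) (hA : Cmp .primrec A)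
    (hW : Cmp .primrec W) : Cmp .primrec fun c => SharpDec.imageEdges (h c) (A c) (W c) :=
  append
    (map (g := fun c a => (a.map (h c)).varList) hA
      (varList (atomMap (h := fun x => h x.1) id.snd (hh.comp (pair id.fst.fst id.snd)))))
    (map (g := fun _ X => [X]) hW (cons id.snd nil))

theorem hasParent {es : γ → List (List ℕ)} {e : γ → List ℕ} (hes : Cmp .primrec es)
    (he : Cmp .primrec e) : Cmp .primrec fun c => SharpDec.hasParent (es c) (e c) :=
  or (beq hes nil) (any (p := fun c f => (e c).all fun x =>
      !((es c).any fun g => decide (x ∈ g)) || decide (x ∈ f)) hes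
    (all (p := fun y x => !((es y.1).any fun g => decide (x ∈ g)) || decide (x ∈ y.2))
      (he.comp id.fst)
      (or (not (any (p := fun z g => decide (z.2 ∈ g)) (hes.comp id.fst.fst)
        (mem id.fst.snd id.snd))) (mem id.snd id.fst.snd))))

theorem hasRunningIntersection {l : γ → List (List ℕ)} (hl : Cmp .primrec l) :
    Cmp .primrec fun c => SharpDec.hasRunningIntersection (l c) :=
  fst (foldr (h := fun _ e (x : Bool × List (List ℕ)) =>
      (x.1 && SharpDec.hasParent x.2 e, e :: x.2)) hl (pair true nil)
    (pair (and id.snd.snd.fst (hasParent id.snd.snd.snd id.snd.fst))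
      (cons id.snd.fst id.snd.snd.snd)))

theorem edgesCovered {E F : γ → List (List ℕ)} (hE : Cmp .primrec E) (hF : Cmp .primrec F) :
    Cmp .primrec fun c => SharpDec.edgesCovered (E c) (F c) :=
  all (p := fun c e => (F c).any fun s => decide (e ⊆ s)) hE
    (any (p := fun x s => decide (x.2 ⊆ s)) (hF.comp id.fst) (subset id.fst.snd id.snd))

theorem respects {W s D e : γ → List ℕ} (hW : Cmp .primrec W) (hs : Cmp .primrec s)
    (hD : Cmp .primrec D) (he : Cmp .primrec e) :
    Cmp .primrec fun c => SharpDec.respects (W c) (s c) (D c) (e c) :=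
  or (not (any (p := fun c x => decide (x ∈ D c) && !decide (x ∈ W c)) he
      (and (mem id.snd (hD.comp id.fst)) (not (mem id.snd (hW.comp id.fst))))))
    (all (p := fun c x => (decide (x ∈ W c) && decide (x ∈ s c)) ||
        (!decide (x ∈ W c) && decide (x ∈ D c))) he
      (or (and (mem id.snd (hW.comp id.fst)) (mem id.snd (hs.comp id.fst)))
        (and (not (mem id.snd (hW.comp id.fst))) (mem id.snd (hD.comp id.fst)))))

theorem frontiersCovered {W : γ → List ℕ} {S E l : γ → List (List ℕ)} (hW : Cmp .primrec W)
    (hS : Cmp .primrec S) (hE : Cmp .primrec E) (hl : Cmp .primrec l) :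
    Cmp .primrec fun c => SharpDec.frontiersCovered (W c) (S c) (E c) (l c) := by
  have h₁ : Cmp .primrec fun x : ((γ × ℕ) × List ℕ) × List ℕ =>
      decide (x.1.1.2 ∈ x.2) &&
        (E x.1.1.1).all fun e => SharpDec.respects (W x.1.1.1) x.1.2 x.2 e :=
    and (mem id.fst.fst.snd id.snd)
      (all (p := fun x e => SharpDec.respects (W x.1.1.1) x.1.2 x.2 e)
        (hE.comp id.fst.fst.fst)
        (respects (hW.comp id.fst.fst.fst.fst) id.fst.fst.snd id.fst.snd id.snd))
  have h₂ : Cmp .primrec fun x : γ × ℕ =>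
      decide (x.2 ∈ W x.1) || (l x.1).any fun s => (S x.1).any fun D =>
        decide (x.2 ∈ D) && (E x.1).all fun e => SharpDec.respects (W x.1) s D e :=
    or (mem id.snd (hW.comp id.fst))
      (any (p := fun x s => (S x.1).any fun D =>
          decide (x.2 ∈ D) && (E x.1).all fun e => SharpDec.respects (W x.1) s D e)
        (hl.comp id.fst)
        (any (p := fun x D => decide (x.1.2 ∈ D) &&
          (E x.1.1).all fun e => SharpDec.respects (W x.1.1) x.2 D e) (hS.comp id.fst.fst) h₁))
  exact all (p := fun c e => e.all fun Y => decide (Y ∈ W c) || (l c).any fun s =>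
      (S c).any fun D => decide (Y ∈ D) &&
        (E c).all fun e => SharpDec.respects (W c) s D e) hE
    (all (p := fun x Y => decide (Y ∈ W x.1) || (l x.1).any fun s => (S x.1).any fun D =>
        decide (Y ∈ D) && (E x.1).all fun e => SharpDec.respects (W x.1) s D e)
      id.snd (h₂.comp (pair id.fst.fst id.snd)))

theorem kernelVars {k : γ → Kernel} (hk : Cmp .primrec k) : Cmp .primrec fun c => (k c).vars :=
  flatMap (g := fun _ => Atom.varList) hk.fst (varList id.snd)

theorem check {k : γ → Kernel} {σ : γ → List (Term × Term)} {l : γ → List (List ℕ)}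
    (hk : Cmp .primrec k) (hσ : Cmp .primrec σ) (hl : Cmp .primrec l) :
    Cmp .primrec fun c => (k c).check (σ c) (l c) := by
  have hs : Cmp .primrec fun x : γ × Term => SharpDec.subst (k x.1).2.1 (σ x.1) x.2 :=
    subst (hk.comp id.fst).snd.fst (hσ.comp id.fst) id.snd
  have hE := imageEdges (h := fun c => SharpDec.subst (k c).2.1 (σ c)) hs hk.fst hk.snd.fst
  have h₁ : Cmp .primrec fun c =>
      (k c).1.all fun a => decide (a.map (SharpDec.subst (k c).2.1 (σ c)) ∈ (k c).1) :=
    all (p := fun c a => decide (a.map (SharpDec.subst (k c).2.1 (σ c)) ∈ (k c).1)) hk.fst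
      (mem (atomMap (h := fun x : γ × Atom ℕ => SharpDec.subst (k x.1).2.1 (σ x.1)) id.snd
        (hs.comp (pair id.fst.fst id.snd))) (hk.comp id.fst).fst)
  exact and (and (and (and h₁ (hasRunningIntersection hl)) (edgesCovered hl hk.snd.snd))
    (edgesCovered hE hl)) (frontiersCovered hk.snd.fst (listsOver (kernelVars hk)) hE hl)

theorem solve : Cmp .primrec Kernel.solve := by
  have h₁ : Cmp .primrec fun x : (Kernel × List (Term × Term) × List (List ℕ)) ×
      List (List ℕ) × List (List ℕ) =>
      bif x.1.1.check x.1.2.1 x.2.1 then x.2.1.flatten :: x.2.1 else x.2.2 :=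
    cond (check id.fst.fst id.fst.snd.fst id.snd.fst)
      (cons ((flatMap (g := fun _ e => e) id.snd.fst id.snd).of_eq fun x => by simp)
        id.snd.fst) id.snd.snd
  exact foldr (h := fun (k : Kernel) σ acc => (SharpDec.listsOver (SharpDec.listsOver k.vars)).foldr
      (fun l acc => bif k.check σ l then l.flatten :: l else acc) acc)
    (listsOver (pairsOf (flatMap (g := fun _ => Atom.args) id.fst (args id.snd)))) nil
    (foldr (h := fun (x : Kernel × List (Term × Term) × List (List ℕ)) l acc =>
        bif x.1.check x.2.1 l then l.flatten :: l else acc)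
      (listsOver (listsOver (kernelVars id.fst))) id.snd.snd h₁)

end Cmp

/-- What is returned by a search through a list of lists of candidates. -/
theorem foldr_foldr_cond {α β γ : Type} (c : α → β → Bool) (out : β → γ) (d : γ) (Bs : List β)
    (As : List α) :
    ((As.foldr (fun a acc => Bs.foldr (fun b acc => bif c a b then out b else acc) acc) d = d) ∧
      ∀ a ∈ As, ∀ b ∈ Bs, c a b = false) ∨
    ∃ a b, c a b = true ∧
      As.foldr (fun a acc => Bs.foldr (fun b acc => bif c a b then out b else acc) acc) d =
        out b := by
  have inner : ∀ a acc, (Bs.foldr (fun b acc => bif c a b then out b else acc) acc = acc ∧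
      ∀ b ∈ Bs, c a b = false) ∨
      ∃ b, c a b = true ∧ Bs.foldr (fun b acc => bif c a b then out b else acc) acc = out b := by
    intro a acc
    induction Bs with
    | nil => exact Or.inl ⟨rfl, by simp⟩
    | cons b Bs ih =>
      rw [List.foldr_cons]
      cases h : c a b
      · simpa [h] using ih
      · exact Or.inr ⟨b, h, rfl⟩
  induction As with
  | nil => exact Or.inl ⟨rfl, by simp⟩
  | cons a As ih =>
    rw [List.foldr_cons]
    rcases inner a (As.foldr (fun a acc =>
      Bs.foldr (fun b acc => bif c a b then out b else acc) acc) d) with ⟨h, h'⟩ | ⟨b, hb, h⟩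
    · rw [h]
      refine ih.imp_left fun h => ⟨h.1, fun a' ha' => ?_⟩
      rcases List.mem_cons.1 ha' with rfl | ha'
      · exact h'
      · exact h.2 a' ha'
    · exact Or.inr ⟨a, b, hb, h⟩

theorem Kernel.solve_spec (k : Kernel) :
    (k.solve = [] ∧ ∀ σ ∈ listsOver (pairsOf (k.1.flatMap Atom.args)),
      ∀ l ∈ listsOver (listsOver k.vars), k.check σ l = false) ∨
    ∃ σ l, k.check σ l = true ∧ k.solve = l.flatten :: l :=
  foldr_foldr_cond k.check (fun l => l.flatten :: l) [] _ _

/-! ### Correctness of the search -/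

/-- The hypergraph with the hyperedges in a list, and with no isolated nodes. -/
def ofEdges (l : List (List ℕ)) : Hypergraph ℕ where
  vertexSet := {X | X ∈ l.flatten}
  edgeSet := {e | ∃ s ∈ l, e = {X | X ∈ s}}
  subset_vertexSet_of_mem_edgeSet' := by
    rintro _ ⟨s, hs, rfl⟩ X hX
    exact List.mem_flatten.2 ⟨s, hs, hX⟩

theorem hasRunningIntersection_cons (e : List ℕ) (es : List (List ℕ)) :
    hasRunningIntersection (e :: es) = (hasRunningIntersection es && hasParent es e) := by
  have key : (es.foldr (fun e (x : Bool × List (List ℕ)) => (x.1 && hasParent x.2 e, e :: x.2))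
      (true, [])).2 = es := by
    induction es with
    | nil => rfl
    | cons e es ih => rw [List.foldr_cons, ih]
  simp only [hasRunningIntersection, List.foldr_cons, key]

theorem hasRunningIntersection_iff (l : List (List ℕ)) : hasRunningIntersection l = true ↔
    RunningIntersection (l.map fun s => {X | X ∈ s}) := by
  induction l with
  | nil => simp [hasRunningIntersection, RunningIntersection]
  | cons e es ih =>
    rw [hasRunningIntersection_cons, Bool.and_eq_true, ih, List.map_cons, RunningIntersection]
    refine and_congr_right fun _ => ?_
    simp [hasParent, imp_iff_not_or]

theorem edgesCovered_iff (E F : List (List ℕ)) :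
    edgesCovered E F = true ↔ ∀ e ∈ E, ∃ s ∈ F, e ⊆ s := by
  simp [edgesCovered]

theorem frontiersCovered_iff (W : List ℕ) (S E l : List (List ℕ)) :
    frontiersCovered W S E l = true ↔ ∀ e ∈ E, ∀ Y ∈ e, Y ∉ W → ∃ s ∈ l, ∃ D ∈ S, Y ∈ D ∧
      ∀ e ∈ E, (∃ x ∈ e, x ∈ D ∧ x ∉ W) → ∀ x ∈ e, (x ∈ W ∧ x ∈ s) ∨ (x ∉ W ∧ x ∈ D) := by
  have h : ∀ s D e, respects W s D e = true ↔
      ((∃ x ∈ e, x ∈ D ∧ x ∉ W) → ∀ x ∈ e, (x ∈ W ∧ x ∈ s) ∨ (x ∉ W ∧ x ∈ D)) := by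
    intro s D e
    rw [respects, Bool.or_eq_true, Bool.not_eq_true', ← Bool.not_eq_true, ← imp_iff_not_or]
    simp
  simp only [frontiersCovered, List.all_eq_true, List.any_eq_true, Bool.or_eq_true,
    Bool.and_eq_true, decide_eq_true_eq, h, or_iff_not_imp_left]

/-- The endomorphisms of the coloring are the endomorphisms of the query that fix the free
variables. -/
theorem isHom_color_iff (Q : Query ℕ) (h : Term → Term) :
    IsHom h Q.color.atomSet Q.color.atomSet ↔ (∀ c, h (.const c) = .const c) ∧
      (∀ X ∈ Q.free, h (.var X) = .var X) ∧ ∀ a ∈ Q.atoms, a.map h ∈ Q.atoms := by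
  have hmem : ∀ b, b ∈ Q.color.atomSet ↔
      (∃ a ∈ Q.atoms, (⟨Sum.inl a.rel, a.args⟩ : Atom (ℕ ⊕ ℕ)) = b) ∨
        ∃ X ∈ Q.freeList, ⟨Sum.inr X, [Term.var X]⟩ = b := by
    intro b
    simp [Query.atomSet, Query.color]
  unfold IsHom
  refine and_congr_right fun _ => ⟨fun H => ⟨fun X hX => ?_, fun a ha => ?_⟩, ?_⟩
  · rcases (hmem _).1 (H _ ((hmem _).2 (Or.inr ⟨X, hX, rfl⟩))) with ⟨a, _, h'⟩ | ⟨Y, _, h'⟩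
    · simp [Atom.map] at h'
    · simp only [Atom.map, List.map_cons, List.map_nil, Atom.mk.injEq, Sum.inr.injEq,
        List.cons.injEq, and_true] at h'
      rw [← h'.2, h'.1]
  · rcases (hmem _).1 (H _ ((hmem _).2 (Or.inl ⟨a, ha, rfl⟩))) with ⟨b, hb, h'⟩ | ⟨Y, _, h'⟩
    · simp only [Atom.map, Atom.mk.injEq, Sum.inl.injEq] at h'
      have : a.map h = b := by
        cases b
        simp_all [Atom.map]
      rwa [this]
    · simp [Atom.map] at h'
  · rintro ⟨hW, hA⟩ b hb
    rcases (hmem b).1 hb with ⟨a, ha, rfl⟩ | ⟨X, hX, rfl⟩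
    · exact (hmem _).2 (Or.inl ⟨_, hA a ha, rfl⟩)
    · refine (hmem _).2 (Or.inr ⟨X, hX, ?_⟩)
      simp [Atom.map, hW X hX]

/-- The hypergraph of the image of the coloring under `h`. -/
theorem edgeSet_image_color {Q : Query ℕ} {A : List (Atom ℕ)} {W : List ℕ}
    (hA : ∀ a, a ∈ A ↔ a ∈ Q.atoms) (hW : ∀ X, X ∈ W ↔ X ∈ Q.free) {h : Term → Term}
    (hh : ∀ X ∈ Q.free, h (.var X) = .var X) (e : Set ℕ) :
    e ∈ (hypergraphOf (Atom.map h '' Q.color.atomSet)).edgeSet ↔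
      ∃ s ∈ imageEdges h A W, e = {X | X ∈ s} := by
  constructor
  · rintro ⟨_, ⟨b, hb, rfl⟩, rfl⟩
    rcases List.mem_append.1 hb with hb | hb
    · obtain ⟨a, ha, rfl⟩ := List.mem_map.1 hb
      exact ⟨_, List.mem_append_left _ (List.mem_map_of_mem ((hA a).2 ha)), rfl⟩
    · obtain ⟨X, hX, rfl⟩ := List.mem_map.1 hb
      refine ⟨[X], List.mem_append_right _ (List.mem_map_of_mem ((hW X).2 hX)), ?_⟩
      simp [Atom.map, Atom.vars, Atom.varList, hh X hX, Term.var?]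
  · rintro ⟨s, hs, rfl⟩
    rcases List.mem_append.1 hs with hs | hs
    · obtain ⟨a, ha, rfl⟩ := List.mem_map.1 hs
      exact ⟨_, ⟨⟨Sum.inl a.rel, a.args⟩, List.mem_append_left _
        (List.mem_map_of_mem (f := fun a : Atom ℕ => (⟨Sum.inl a.rel, a.args⟩ : Atom (ℕ ⊕ ℕ)))
          ((hA a).1 ha)), rfl⟩, rfl⟩
    · obtain ⟨X, hX, rfl⟩ := List.mem_map.1 hs
      refine ⟨_, ⟨⟨Sum.inr X, [Term.var X]⟩, List.mem_append_right _
        (List.mem_map_of_mem (f := fun X => (⟨Sum.inr X, [Term.var X]⟩ : Atom (ℕ ⊕ ℕ)))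
          ((hW X).1 hX)), rfl⟩, ?_⟩
      simp [Atom.map, Atom.vars, Atom.varList, hh X ((hW X).1 hX), Term.var?]

/-- For the hypergraph of a set of atoms that is covered, the frontier hypergraph is covered as
soon as the frontiers of the nodes outside `W` are. -/
theorem covers_frontierHypergraph_iff {R : Type} {B : Set (Atom R)} (hB : B.Nonempty) {W : Set ℕ}
    {Ha : Hypergraph ℕ} (hcov : Covers (hypergraphOf B) Ha) :
    Covers (frontierHypergraph (hypergraphOf B) W) Ha ↔
      ∀ e ∈ (hypergraphOf B).edgeSet, ∀ Y ∈ e, Y ∉ W →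
        ∃ s ∈ Ha.edgeSet, frontier Y W (hypergraphOf B) ⊆ s := by
  constructor
  · intro h e he Y hY _
    exact h _ (Or.inl ⟨Y, mem_vertexSet_hypergraphOf.2 ⟨e, he, hY⟩, rfl⟩)
  · rintro h e (⟨Y, hY, rfl⟩ | ⟨he, -⟩)
    · by_cases hYW : Y ∈ W
      · obtain ⟨b, hb⟩ := hB
        obtain ⟨s, hs, -⟩ := hcov _ ⟨b, hb, rfl⟩
        refine ⟨s, hs, ?_⟩
        rw [frontier, if_pos hYW]
        exact Set.empty_subset _
      · obtain ⟨e, he, hYe⟩ := mem_vertexSet_hypergraphOf.1 hY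
        exact h e he Y hYe hYW
    · exact hcov e he

/-- The kernel `k` describes the instance given by `Q` and `V`. -/
structure Kernel.Describes (k : Kernel) (Q : Query ℕ) (V : List (Atom ℕ)) : Prop where
  mem_atoms : ∀ a, a ∈ k.1 ↔ a ∈ Q.atoms
  mem_free : ∀ X, X ∈ k.2.1 ↔ X ∈ Q.free
  mem_views : ∀ s, s ∈ k.2.2 ↔ ∃ w ∈ V, k.vars.filter (fun X => decide (X ∈ w.varList)) = s

theorem subst_const (W : List ℕ) (σ : List (Term × Term)) (c : ℕ) :
    subst W σ (.const c) = .const c := by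
  simp [subst, Term.isConst]

theorem subst_free {W : List ℕ} {σ : List (Term × Term)} {X : ℕ} (h : X ∈ W) :
    subst W σ (.var X) = .var X := by
  simp [subst, Term.name, h]

/-- Soundness of the search. -/
theorem Kernel.isSharpDecomposition_of_check {k : Kernel} {Q : Query ℕ} {V : List (Atom ℕ)}
    (hk : k.Describes Q V) {σ : List (Term × Term)} {l : List (List ℕ)}
    (hc : k.check σ l = true) : IsSharpDecomposition (ofEdges l) Q V := by
  obtain ⟨A, W, VS⟩ := k
  simp only [Kernel.check, Bool.and_eq_true, List.all_eq_true, decide_eq_true_eq,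
    hasRunningIntersection_iff, edgesCovered_iff, frontiersCovered_iff] at hc
  obtain ⟨⟨⟨⟨hhom, hrip⟩, hV⟩, hE⟩, hF⟩ := hc
  have hA : ∀ a, a ∈ A ↔ a ∈ Q.atoms := hk.mem_atoms
  have hW : ∀ X, X ∈ W ↔ X ∈ Q.free := hk.mem_free
  have hVS := hk.mem_views
  simp only at hVS
  set h := subst W σ with hh
  have hfix : ∀ X ∈ Q.free, h (.var X) = .var X := fun X hX => subst_free ((hW X).2 hX)
  have hedge := edgeSet_image_color hA hW hfix
  have hcov : Covers (hypergraphOf (Atom.map h '' Q.color.atomSet)) (ofEdges l) := by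
    intro e he
    obtain ⟨s, hs, rfl⟩ := (hedge e).1 he
    obtain ⟨s', hs', hss⟩ := hE s hs
    exact ⟨_, ⟨s', hs', rfl⟩, fun x hx => hss hx⟩
  have hne : (Atom.map h '' Q.color.atomSet).Nonempty := by
    obtain ⟨a, ha⟩ := List.exists_mem_of_ne_nil _ Q.color.atoms_ne_nil
    exact ⟨_, a, ha, rfl⟩
  refine (exists_core_iff_exists_hom (List.finite_toSet _) _ _ _).2 ⟨h, (isHom_color_iff Q h).2
    ⟨subst_const W σ, hfix, fun a ha => (hA _).1 (hhom a ((hA a).2 ha))⟩,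
    ⟨List.finite_toSet _, hrip.isAcyclic fun e => ?_, hcov, ?_⟩, ?_⟩
  · simp [ofEdges, eq_comm]
  · rintro _ ⟨s, hs, rfl⟩
    obtain ⟨s', hs', hss⟩ := hV s hs
    obtain ⟨w, hw, rfl⟩ := (hVS s').1 hs'
    refine ⟨_, ⟨w, hw, rfl⟩, fun x hx => ?_⟩
    have h := (List.mem_filter.1 (hss hx)).2
    exact of_decide_eq_true (p := x ∈ w.varList) h
  · refine (covers_frontierHypergraph_iff hne hcov).2 fun e he Y hY hYW => ?_
    have hYV := mem_vertexSet_hypergraphOf.2 ⟨e, he, hY⟩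
    obtain ⟨s, hs, rfl⟩ := (hedge e).1 he
    obtain ⟨s', hs', D, -, hYD, hD⟩ := hF s hs Y hY (fun hY' => hYW ((hW Y).1 hY'))
    refine ⟨_, ⟨s', hs', rfl⟩, (frontier_subset_iff hYV hYW _).2
      ⟨{x | x ∈ D} ∩ (hypergraphOf (Atom.map h '' Q.color.atomSet)).vertexSet,
        Set.inter_subset_right, ⟨hYD, hYV⟩, ?_⟩⟩
    rintro e' he' ⟨x, hx, hxD, hxW⟩ z hz
    have hzV := mem_vertexSet_hypergraphOf.2 ⟨e', he', hz⟩
    obtain ⟨s'', hs'', rfl⟩ := (hedge e').1 he'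
    refine (hD s'' hs'' ⟨x, hx, hxD.1, fun h => hxW ((hW x).1 h)⟩ z hz).imp
      (fun h => ⟨(hW z).1 h.1, h.2⟩) (fun h => ⟨fun h' => h.1 ((hW z).2 h'), h.2, hzV⟩)

theorem mem_pairsOf {α : Type} {l : List α} {x : α × α} :
    x ∈ pairsOf l ↔ x.1 ∈ l ∧ x.2 ∈ l := by
  obtain ⟨a, b⟩ := x
  simp [pairsOf]

theorem length_le_length_pairsOf {α : Type} (l : List α) : l.length ≤ (pairsOf l).length := by
  have : (pairsOf l).length = l.length * l.length := by
    simp [pairsOf, List.length_flatMap]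
  rw [this]
  exact Nat.le_mul_self _

/-- Each map that fixes the constants and the variables in `W` is described by a list of pairs. -/
theorem subst_map {W : List ℕ} {T : List Term} {h : Term → Term}
    (hc : ∀ c, h (.const c) = .const c) (hW : ∀ X ∈ W, h (.var X) = .var X) {t : Term}
    (ht : t ∈ T) : subst W (T.map fun t => (t, h t)) t = h t := by
  have key : ∀ T : List Term, t ∈ T →
      (T.map fun t => (t, h t)).foldr (fun p u => if p.1 = t then p.2 else u) t = h t := by
    intro T
    induction T with
    | nil => simp
    | cons u T ih =>
      intro htT
      by_cases hu : u = t
      · simp [hu]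
      · simpa [hu] using ih ((List.mem_cons.1 htT).resolve_left (Ne.symm hu))
  unfold subst
  split_ifs with h'
  · cases t with
    | const c => exact (hc c).symm
    | var X =>
      refine (hW X ?_).symm
      exact of_decide_eq_true h'
  · exact key T ht

theorem filter_mem_listsOver {α : Type} (U : List α) (p : α → Bool) :
    U.filter p ∈ listsOver U :=
  mem_listsOver (List.length_filter_le _ _) (List.filter_subset_self _)

/-- Completeness of the search: the hyperedges of a given #-decomposition are restricted to the
variables of the query and listed with the running intersection property. -/
theorem Kernel.exists_check {k : Kernel} {Q : Query ℕ} {V : List (Atom ℕ)}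
    (hk : k.Describes Q V) {Ha : Hypergraph ℕ} (hHa : IsSharpDecomposition Ha Q V) :
    ∃ σ ∈ listsOver (pairsOf (k.1.flatMap Atom.args)),
      ∃ l ∈ listsOver (listsOver k.vars), k.check σ l = true := by
  classical
  obtain ⟨h, hhom, ⟨hfin, hacyc, hcov, hcovV⟩, hfr⟩ :=
    (exists_core_iff_exists_hom (List.finite_toSet Q.color.atoms) _ _ _).1 hHa
  change IsHom h Q.color.atomSet Q.color.atomSet at hhom
  change Covers (hypergraphOf (Atom.map h '' Q.color.atomSet)) Ha at hcov
  change Covers (frontierHypergraph (hypergraphOf (Atom.map h '' Q.color.atomSet)) Q.free) Ha at hfr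
  obtain ⟨hconst, hfix, hmap⟩ := (isHom_color_iff Q h).1 hhom
  obtain ⟨r, hr, hrE⟩ := hacyc.exists_runningIntersection hfin
  have hne : (Atom.map h '' Q.color.atomSet).Nonempty := by
    obtain ⟨a, ha⟩ := List.exists_mem_of_ne_nil _ Q.color.atoms_ne_nil
    exact ⟨_, a, ha, rfl⟩
  rw [covers_frontierHypergraph_iff hne hcov] at hfr
  obtain ⟨A, W, VS⟩ := k
  have hA : ∀ a, a ∈ A ↔ a ∈ Q.atoms := hk.mem_atoms
  have hW : ∀ X, X ∈ W ↔ X ∈ Q.free := hk.mem_free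
  have hVS := hk.mem_views
  simp only at hVS
  have hedge := edgeSet_image_color hA hW hfix
  set U := Kernel.vars (A, W, VS) with hU
  have hWU : ∀ X ∈ W, X ∈ U := by
    intro X hX
    obtain ⟨a, ha, hXa⟩ := List.mem_flatMap.1 (List.mem_filter.1 ((hW X).1 hX)).1
    exact List.mem_flatMap.2 ⟨a, (hA a).2 ha, hXa⟩
  have hEU : ∀ s ∈ imageEdges h A W, ∀ X ∈ s, X ∈ U := by
    intro s hs X hX
    rcases List.mem_append.1 hs with hs | hs
    · obtain ⟨a, ha, rfl⟩ := List.mem_map.1 hs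
      exact List.mem_flatMap.2 ⟨_, (hA _).2 (hmap a ((hA a).1 ha)), hX⟩
    · obtain ⟨Y, hY, rfl⟩ := List.mem_map.1 hs
      rw [List.mem_singleton.1 hX]
      exact hWU Y hY
  -- the part in `U` of a set of nodes, as a list
  let part : Set ℕ → List ℕ := fun s => U.filter fun X => decide (X ∈ s)
  have hpart : ∀ s X, X ∈ part s ↔ X ∈ U ∧ X ∈ s := fun s X => by simp [part]
  have hargs : ∀ a ∈ A, ∀ t ∈ a.args, t ∈ A.flatMap Atom.args :=
    fun a ha t ht => List.mem_flatMap.2 ⟨a, ha, ht⟩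
  have hsubst : ∀ a ∈ A,
      a.map (subst W ((A.flatMap Atom.args).map fun t => (t, h t))) = a.map h := by
    intro a ha
    simp only [Atom.map, Atom.mk.injEq, true_and]
    exact List.map_congr_left fun t ht => subst_map hconst (fun X hX => hfix X ((hW X).1 hX))
      (hargs a ha t ht)
  have hE : imageEdges (subst W ((A.flatMap Atom.args).map fun t => (t, h t))) A W =
      imageEdges h A W := by
    simp only [imageEdges]
    congr 1
    exact List.map_congr_left fun a ha => by rw [hsubst a ha]
  have hl : ∀ s, s ∈ (r.map part).dedup ↔ ∃ e ∈ Ha.edgeSet, part e = s := by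
    simp [hrE]
  refine ⟨(A.flatMap Atom.args).map fun t => (t, h t), mem_listsOver ?_ ?_, (r.map part).dedup,
    mem_listsOver ?_ ?_, ?_⟩
  · rw [List.length_map]
    exact length_le_length_pairsOf _
  · intro x hx
    obtain ⟨t, ht, rfl⟩ := List.mem_map.1 hx
    refine mem_pairsOf.2 ⟨ht, ?_⟩
    obtain ⟨a, ha, hta⟩ := List.mem_flatMap.1 ht
    exact hargs _ ((hA _).2 (hmap a ((hA a).1 ha))) _ (List.mem_map_of_mem hta)
  · refine ((List.nodup_dedup _).subperm fun s hs => ?_).length_le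
    obtain ⟨e, -, rfl⟩ := (hl s).1 hs
    exact filter_mem_listsOver _ _
  · intro s hs
    obtain ⟨e, -, rfl⟩ := (hl s).1 hs
    exact filter_mem_listsOver _ _
  · simp only [Kernel.check, Bool.and_eq_true, List.all_eq_true, decide_eq_true_eq,
      hasRunningIntersection_iff, edgesCovered_iff, frontiersCovered_iff, hE]
    refine ⟨⟨⟨⟨fun a ha => ?_, ?_⟩, fun s hs => ?_⟩, fun s hs => ?_⟩, fun s hs Y hY hYW => ?_⟩
    · rw [hsubst a ha]
      exact (hA _).2 (hmap a ((hA a).1 ha))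
    · refine RunningIntersection.map_dedup ?_
      rw [List.map_map]
      refine (congrArg RunningIntersection (List.map_congr_left fun e _ => ?_)).mp
        (hr.map_inter {x | x ∈ U})
      ext X
      exact (hpart e X).symm
    · obtain ⟨e, he, rfl⟩ := (hl s).1 hs
      obtain ⟨_, ⟨w, hw, rfl⟩, hew⟩ := hcovV e he
      refine ⟨_, (hVS _).2 ⟨w, hw, rfl⟩, fun X hX => ?_⟩
      rw [hpart] at hX
      exact List.mem_filter.2 ⟨hX.1, decide_eq_true (p := X ∈ w.varList) (hew hX.2)⟩
    · obtain ⟨e, he, hse⟩ := hcov _ ((hedge _).2 ⟨s, hs, rfl⟩)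
      exact ⟨_, (hl _).2 ⟨e, he, rfl⟩, fun X hX => (hpart _ _).2 ⟨hEU s hs X hX, hse hX⟩⟩
    · have hs' := (hedge _).2 ⟨s, hs, rfl⟩
      have hYW' : Y ∉ Q.free := fun h => hYW ((hW Y).2 h)
      obtain ⟨e, he, hfe⟩ := hfr _ hs' Y hY hYW'
      obtain ⟨D, hDV, hYD, hD⟩ := (frontier_subset_iff
        (mem_vertexSet_hypergraphOf.2 ⟨_, hs', hY⟩) hYW' e).1 hfe
      refine ⟨_, (hl _).2 ⟨e, he, rfl⟩, part D, filter_mem_listsOver _ _,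
        (hpart _ _).2 ⟨hEU s hs Y hY, hYD⟩, ?_⟩
      rintro s' hs' ⟨x, hx, hxD, hxW⟩ z hz
      have := hD _ ((hedge _).2 ⟨s', hs', rfl⟩)
        ⟨x, hx, ((hpart _ _).1 hxD).2, fun h => hxW ((hW x).2 h)⟩ z hz
      exact this.imp (fun h => ⟨(hW z).2 h.1, (hpart _ _).2 ⟨hEU s' hs' z hz, h.2⟩⟩)
        (fun h => ⟨fun h' => h.1 ((hW z).1 h'), (hpart _ _).2 ⟨hEU s' hs' z hz, h.2⟩⟩)

/-! ### The kernel of an instance -/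

/-- The kernel of an instance that is given by the atoms of the query, its quantified variables,
and the views. Duplicates are removed, so that its weight is bounded in terms of the query size. -/
def kernelOf (x : (List (Atom ℕ) × List ℕ) × List (Atom ℕ)) : Kernel :=
  (x.1.1.dedup,
    (x.1.1.dedup.flatMap Atom.varList).filter fun X => !decide (X ∈ x.1.2),
    (x.2.map fun w =>
      (x.1.1.dedup.flatMap Atom.varList).filter fun X => decide (X ∈ w.varList)).dedup)

theorem Cmp.kernelOf : Cmp .poly kernelOf := by
  have hA : Cmp .poly fun x : (List (Atom ℕ) × List ℕ) × List (Atom ℕ) => x.1.1.dedup :=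
    dedup id.fst.fst
  have hU : Cmp .poly fun x : (List (Atom ℕ) × List ℕ) × List (Atom ℕ) =>
      x.1.1.dedup.flatMap Atom.varList := flatMap (g := fun _ => Atom.varList) hA (varList id.snd)
  exact pair hA (pair
    (filter (p := fun x X => !decide (X ∈ x.1.2)) hU (not (mem id.snd id.fst.fst.snd)))
    (dedup (map (g := fun (x : (List (Atom ℕ) × List ℕ) × List (Atom ℕ)) w =>
        (x.1.1.dedup.flatMap Atom.varList).filter fun X => decide (X ∈ w.varList)) id.snd
      (filter (p := fun (x : ((List (Atom ℕ) × List ℕ) × List (Atom ℕ)) × Atom ℕ) X =>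
        decide (X ∈ x.2.varList)) (hU.comp id.fst)
        (mem id.snd (varList id.fst.snd))))))

theorem kernelOf_describes (Q : Query ℕ) (V : List (Atom ℕ)) :
    (kernelOf ((Q.atoms, Q.quantified), V)).Describes Q V where
  mem_atoms a := List.mem_dedup
  mem_free X := by simp [kernelOf, Query.free, Query.freeList]
  mem_views s := by simp [kernelOf, Kernel.vars]

/-- A bound for the weight of the kernel in terms of the query size `k`. -/
def kernelBound (k : ℕ) : ℕ := 5 + 10 * k + 2 ^ k * (2 + 2 * k)

/-- An atom without arguments is determined by its symbol, and every other atom contributes to the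
sum of the arities; hence the bound for the number of atoms. -/
theorem length_dedup_le_size (Q : Query ℕ) :
    Q.atoms.dedup.length ≤ Q.size ∧ (Q.atoms.dedup.map fun a => a.args.length).sum ≤ Q.size := by
  have hsum : ∑ a ∈ Q.atoms.toFinset, a.args.length =
      (Q.atoms.dedup.map fun a => a.args.length).sum := by
    rw [← List.sum_toFinset _ (List.nodup_dedup _)]
    refine Finset.sum_congr ?_ fun _ _ => rfl
    ext a
    simp
  have hnull : (Q.atoms.toFinset.filter fun a => a.args = []).card ≤
      (Q.atoms.map Atom.symbol).toFinset.card := by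
    refine Finset.card_le_card_of_injOn Atom.symbol (fun a ha => ?_) fun a ha b hb hab => ?_
    · have := (Finset.mem_filter.1 ha).1
      simp only [List.coe_toFinset, List.mem_map, Set.mem_ofPred_eq]
      exact ⟨a, List.mem_toFinset.1 this, rfl⟩
    · have ha := (Finset.mem_filter.1 ha).2
      have hb := (Finset.mem_filter.1 hb).2
      cases a
      cases b
      simp_all [Atom.symbol]
  have hpos : (Q.atoms.toFinset.filter fun a => ¬ a.args = []).card ≤
      ∑ a ∈ Q.atoms.toFinset, a.args.length := by
    rw [Finset.card_eq_sum_ones]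
    refine (Finset.sum_le_sum fun a ha => ?_).trans
      (Finset.sum_le_sum_of_subset (Finset.filter_subset _ _))
    exact List.length_pos_iff.2 (Finset.mem_filter.1 ha).2
  have hcard := Finset.card_filter_add_card_filter_not (s := Q.atoms.toFinset)
    (fun a : Atom ℕ => a.args = [])
  rw [List.card_toFinset] at hcard
  unfold Query.size
  omega

theorem wt_names (l : List ℕ) : wt l = 1 + 2 * l.length := by
  rw [wt_list]
  change 1 + (l.map fun _ => 1 + 1).sum = _
  simp
  omega

/-- There are at most `2 ^ k` distinct traces of the views on the variables of the query, since each
of them is a sublist of the list of these variables. -/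
theorem wt_kernelOf_le (Q : Query ℕ) (V : List (Atom ℕ)) :
    wt (kernelOf ((Q.atoms, Q.quantified), V)) ≤ kernelBound Q.size := by
  obtain ⟨hlen, hsum⟩ := length_dedup_le_size Q
  have hA : wt Q.atoms.dedup ≤ 1 + 8 * Q.size := by
    have : wt Q.atoms.dedup =
        1 + (4 * Q.atoms.dedup.length + 4 * (Q.atoms.dedup.map fun a => a.args.length).sum) := by
      simp only [wt_list Q.atoms.dedup, wt_atom]
      congr 1
      induction Q.atoms.dedup with
      | nil => rfl
      | cons a l ih =>
        simp only [List.map_cons, List.sum_cons, List.length_cons, ih]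
        omega
    omega
  set U := Q.atoms.dedup.flatMap Atom.varList with hU
  have hUlen : U.length ≤ Q.size := by
    refine le_trans ?_ hsum
    rw [hU, List.length_flatMap]
    exact List.sum_le_sum fun a _ => List.length_filterMap_le _ _
  have hW : ∀ p : ℕ → Bool, wt (U.filter p) ≤ 1 + 2 * Q.size := by
    intro p
    have := List.length_filter_le p U
    rw [wt_names]
    omega
  have hV : wt (V.map fun w => U.filter fun X => decide (X ∈ w.varList)).dedup ≤
      1 + 2 ^ Q.size * (2 + 2 * Q.size) := by
    refine (wt_list_le (k := 1 + 2 * Q.size) fun s hs => ?_).trans ?_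
    · obtain ⟨w, -, rfl⟩ := List.mem_map.1 (List.mem_dedup.1 hs)
      exact hW _
    · refine Nat.add_le_add_left (Nat.mul_le_mul ?_ (by omega)) 1
      refine le_trans ?_ (Nat.pow_le_pow_right two_pos hUlen)
      rw [← List.length_sublists]
      refine ((List.nodup_dedup _).subperm fun s hs => ?_).length_le
      obtain ⟨w, -, rfl⟩ := List.mem_map.1 (List.mem_dedup.1 hs)
      exact List.mem_sublists.2 List.filter_sublist
  have h₁ := hW fun X => !decide (X ∈ Q.quantified)
  simp only [kernelOf, wt_mk, kernelBound]
  rw [← hU]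
  omega

theorem primrec_kernelBound : Primrec kernelBound := by
  have hpow : Primrec fun k : ℕ => 2 ^ k := by
    refine (Primrec.nat_rec' (f := fun k : ℕ => k) (g := fun _ => 1) (h := fun _ x => x.2 * 2)
      Primrec.id (Primrec.const 1) ?_).of_eq fun k => ?_
    · exact Primrec.nat_mul.comp (Primrec.snd.comp Primrec.snd) (Primrec.const 2)
    · induction k with
      | zero => rfl
      | succ k ih => rw [pow_succ, ← ih]
  have hlin : ∀ a b : ℕ, Primrec fun k => a + b * k := fun a b =>
    Primrec.nat_add.comp (Primrec.const a) (Primrec.nat_mul.comp (Primrec.const b) Primrec.id)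
  exact Primrec.nat_add.comp (hlin 5 10) (Primrec.nat_mul.comp hpow (hlin 2 2))

theorem correctOutput_solve (x : Instance) : x.CorrectOutput
    (enc (kernelOf ((x.query.atoms, x.query.quantified), x.views)).solve) := by
  have hk := kernelOf_describes x.query x.views
  rcases Kernel.solve_spec (kernelOf ((x.query.atoms, x.query.quantified), x.views)) with
    ⟨h, hno⟩ | ⟨σ, l, hc, h⟩
  · have hno' : ¬ ∃ H, IsSharpDecomposition H x.query x.views := by
      rintro ⟨H, hH⟩
      obtain ⟨σ, hσ, l, hl, hc⟩ := Kernel.exists_check hk hH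
      exact Bool.false_ne_true ((hno σ hσ l hl).symm.trans hc)
    rw [h]
    exact ⟨fun h' => absurd h' hno', fun _ => rfl⟩
  · have hdec := Kernel.isSharpDecomposition_of_check hk hc
    rw [h]
    exact ⟨fun _ => ⟨ofEdges l, hdec, l.flatten, l, rfl, rfl, rfl⟩, fun h' => absurd ⟨_, hdec⟩ h'⟩

end SharpDec

open SharpDec SharpDec.Enc in
theorem mainTheorem4 :
    SharpDec.FixedParameterTractable SharpDec.Instance.encode SharpDec.Instance.param
      SharpDec.Instance.CorrectOutput := by
  obtain ⟨p, m, S, a, ⟨-, d, hS⟩, -, hSb, hSm⟩ := Cmp.kernelOf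
  obtain ⟨q, m', T, b, ⟨hT, hTp⟩, -, -, hTm⟩ := Cmp.solve
  refine ⟨.seq p q, fun k => (1 + T (kernelBound k)) * 3 ^ (d + a + b), d + a + b, ?_, fun x => ?_⟩
  · exact (Primrec.nat_mul.comp (Primrec.nat_add.comp (Primrec.const 1)
      (hTp.comp primrec_kernelBound)) (Primrec.const _)).to_comp
  set y := ((x.query.atoms, x.query.quantified), x.views)
  set n := x.encode.size
  have hn1 : 1 ≤ n := Data.one_le_size _
  have hbd : bd n y := bd_size y
  have hrun := ((hSm n y hbd).mono (le_max_left m m') le_rfl).seq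
    ((hTm n _ (hSb n y hbd)).mono (le_max_right m m') le_rfl)
  obtain ⟨s, t, hr, hs, -, ht⟩ := hrun (Function.update (fun _ => Data.nil) 0 (enc y)) (by simp)
  refine ⟨_, t, ⟨s, hr, hs⟩, ht.trans ?_, correctOutput_solve x⟩
  -- since `1 ≤ n`, both `n + 1` and `n + 2` are at most `3 * n`
  have h₁ : S (wt y) * (n + 1) ^ a ≤ (3 * n) ^ (d + a + b) := by
    have hw : wt y ≤ n := wt_le y
    calc S (wt y) * (n + 1) ^ a ≤ (3 * n) ^ d * (3 * n) ^ a := by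
          refine Nat.mul_le_mul ((hS _).trans (Nat.pow_le_pow_left (by omega) _))
            (Nat.pow_le_pow_left (by omega) _)
      _ = (3 * n) ^ (d + a) := (pow_add _ _ _).symm
      _ ≤ _ := Nat.pow_le_pow_right (by omega) (by omega)
  have h₂ : T (wt (kernelOf y)) * (n + 1) ^ b ≤
      T (kernelBound x.param) * (3 * n) ^ (d + a + b) :=
    Nat.mul_le_mul (hT (wt_kernelOf_le _ _)) ((Nat.pow_le_pow_left (by omega) _).trans
      (Nat.pow_le_pow_right (by omega) (by omega)))
  calc _ ≤ (3 * n) ^ (d + a + b) + T (kernelBound x.param) * (3 * n) ^ (d + a + b) :=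
        add_le_add h₁ h₂
    _ = _ := by rw [mul_pow]; ring
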